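/- **Conventions.** Let $V$ be a finite-dimensional real vector space. A *simplicial fan* $\Sigma$ in $V$ is a finite set of simplicial cones (cones generated by finitely many linearly independent vectors) that is closed under passing to faces and in which any two cones intersect in a common face. It is a *$d$-fan* if all its inclusion-maximal cones have dimension $d$. Write $\Sigma(k)$ for the set of $k$-dimensional cones of $\Sigma$, $|\Sigma|$ for the union of its cones, $V_\sigma$ for the span of a cone $\sigma$, and $\sigma(1)$ for the set of rays of $\sigma$. A *marking* $u$ is a choice of a nonzero vector $u_\rho\in\rho$ for every $\rho\in\Sigma(1)$. If $\tau$ is a face of codimension one of $\sigma\in\Sigma$, let $u_{\sigma\setminus\tau}$ be the mark of the unique ray in $\sigma(1)\setminus\tau(1)$. A *Minkowski $k$-weight* on $(\Sigma,u)$ is a function $\omega:\Sigma(k)\to\mathbb R$ with $\sum_{\sigma\in\Sigma(k),\,\sigma\succ\tau}\omega(\sigma)u_{\sigma\setminus\tau}\in V_\tau$ for all $\tau\in\Sigma(k-1)$. A *marked tropical $d$-fan* $\mathbf\Sigma(u)=(\Sigma,u,\omega)$ is a simplicial $d$-fan with a marking $u$ and a Minkowski $d$-weight $\omega$ all of whose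 values are positive. Divisors: $PL(\Sigma)$ is the space of continuous functions $\phi:|\Sigma|\to\mathbb R$ that agree on each cone $\sigma\in\Sigma$ with a linear function $\phi_\sigma\in V^\vee$, $L(\Sigma)\subseteq PL(\Sigma)$ is the subspace of restrictions of linear functions on $V$, and $D(\Sigma)=PL(\Sigma)/L(\Sigma)$. The class $D$ of $\phi$ acts on a Minkowski $k$-weight $\omega$ and gives the Minkowski $(k-1)$-weight $$(D\cdot\omega)(\tau)=\sum_{\sigma\in\Sigma(k),\,\sigma\succ\tau}\phi_\sigma\big(\omega(\sigma)u_{\sigma\setminus\tau}\big)-\phi_\tau\Big(\sum_{\sigma\in\Sigma(k),\,\sigma\succ\tau}\omega(\sigma)u_{\sigma\setminus\tau}\Big),$$ and the *mixed degree* of $D_1,\dots,D_d\in D(\Sigma)$ is $\deg_{\mathbf\Sigma(u)}(D_1\cdots D_d)=(D_1\cdots D_d\cdot\omega)(0)$. Stars: for $\tau\in\Sigma$, the neighborhood $N_\tau\Sigma$ is the set of all faces of cones of $\Sigma$ containing $\tau$ as a face, and the *star* $\Sigma^\tau$ is the fan in $V/V_\tau$ consisting of the images of the cones of $N_\tau\Sigma$;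 it is a simplicial $d^\tau$-fan with $d^\tau=d-\dim\tau$. Each ray (resp. maximal cone) of $\Sigma^\tau$ is the image of a unique ray (resp. $d$-dimensional cone) of $N_\tau\Sigma$, and thereby inherits a mark $u^\tau$ (resp. a weight $\omega^\tau$); write $\mathbf\Sigma(u)^\tau=(\Sigma^\tau,u^\tau,\omega^\tau)$. A divisor $D$ is *strictly convex* if for every $\tau\in\Sigma$ it has a representative that vanishes on $\tau$ and is strictly positive on $|N_\tau\Sigma|\setminus\tau$. Let $K(\Sigma)$ be the set of strictly convex divisors; $\Sigma$ is *quasiprojective* if $K(\Sigma)\ne\emptyset$. A marked tropical $d$-fan $\mathbf\Sigma(u)$ is *Lorentzian* if $\Sigma$ is quasiprojective and, for every $\tau\in\Sigma$ with $d^\tau\ge 2$ and all $D_3,\dots,D_{d^\tau}\in K(\Sigma^\tau)$, the symmetric bilinear form $D(\Sigma^\tau)\times D(\Sigma^\tau)\to\mathbb R$, $(D_1,D_2)\mapsto\deg_{\mathbf\Sigma(u)^\tau}(D_1D_2D_3\cdots D_{d^\tau})$, has exactly one positive eigenvalue (i.e. signature $(1,q,r)$). **Theorem.** Let $\mathbf\Sigma(u)=(\Sigma,u,\omega)$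 be a quasiprojective marked tropical $d$-fan. Then $\mathbf\Sigma(u)$ is Lorentzian if and only if (A) $\Sigma$ is unpinched: for every $\tau\in\Sigma$ with $\dim\tau\le d-2$, the set $|\Sigma^\tau|\setminus\{0\}$ is connected; and (B) the $2$-dimensional star $\mathbf\Sigma(u)^\tau$ is Lorentzian for every $\tau\in\Sigma(d-2)$. Moreover, for every $\tau\in\Sigma(d-2)$, the star $\mathbf\Sigma(u)^\tau$ is Lorentzian if and only if the single form $(D_1,D_2)\mapsto\deg_{\mathbf\Sigma(u)^\tau}(D_1D_2)$ on $D(\Sigma^\tau)$ has exactly one positive eigenvalue. -/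

import Mathlib

noncomputable section

namespace LorentzianFan

open scoped Classical

section Fans

variable {V : Type*} [AddCommGroup V] [Module ℝ V]

/-- The linear span `V_σ` of a cone `σ`. -/
def coneSpan (σ : PointedCone ℝ V) : Submodule ℝ V := Submodule.span ℝ (σ : Set V)

/-- The dimension of a cone, i.e. the dimension of its linear span. -/
def coneDim (σ : PointedCone ℝ V) : ℕ := Module.finrank ℝ (coneSpan σ)

/-- A finite set `F` of cones is a simplicial fan: all its cones are simplicial (generated by
finitely many linearly independent vectors), it is closed under passing to faces, and any two of
its cones meet along a common face. -/
structure IsSimplicialFan (F : Finset (PointedCone ℝ V)) : Prop where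
  simplicial : ∀ σ ∈ F, σ.IsSimplicial
  face_mem : ∀ σ ∈ F, ∀ τ : PointedCone ℝ V, τ.IsFaceOf σ → τ ∈ F
  inter_isFaceOf_left : ∀ σ₁ ∈ F, ∀ σ₂ ∈ F, (σ₁ ⊓ σ₂).IsFaceOf σ₁
  inter_isFaceOf_right : ∀ σ₁ ∈ F, ∀ σ₂ ∈ F, (σ₁ ⊓ σ₂).IsFaceOf σ₂

/-- `F` is pure of dimension `d`: every inclusion-maximal cone of `F` has dimension `d`. -/
def IsPureOfDim (F : Finset (PointedCone ℝ V)) (d : ℕ) : Prop :=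
  ∀ σ, Maximal (· ∈ F) σ → coneDim σ = d

/-- The `k`-dimensional cones `F(k)` of `F`. -/
def conesOfDim (F : Finset (PointedCone ℝ V)) (k : ℕ) : Finset (PointedCone ℝ V) :=
  F.filter (fun σ => coneDim σ = k)

/-- The rays `σ(1)` of a cone `σ` of the fan `F`. -/
def raysOf (F : Finset (PointedCone ℝ V)) (σ : PointedCone ℝ V) : Finset (PointedCone ℝ V) :=
  (conesOfDim F 1).filter (fun ρ => ρ.IsFaceOf σ)

/-- The cones of `F` that have `τ` as a face of codimension one. -/
def cofaces (F : Finset (PointedCone ℝ V)) (τ : PointedCone ℝ V) : Finset (PointedCone ℝ V) :=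
  (conesOfDim F (coneDim τ + 1)).filter (fun σ => τ.IsFaceOf σ)

/-- The support `|F|`: the union of all cones of `F`. -/
def support (F : Finset (PointedCone ℝ V)) : Set V := ⋃ σ ∈ F, (σ : Set V)

/-- A marking: the choice, for every ray `ρ` of `F`, of a vector in the relative interior of `ρ`,
that is, of a nonzero vector of `ρ`. Values of `u` on other cones are irrelevant. -/
def IsMarking (F : Finset (PointedCone ℝ V)) (u : PointedCone ℝ V → V) : Prop :=
  ∀ ρ ∈ conesOfDim F 1, u ρ ∈ ρ ∧ u ρ ≠ 0

/-- The vector `u_{σ∖τ}`: if `τ` is a face of codimension one of `σ` in a simplicial fan, then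
`σ(1) ∖ τ(1)` consists of one ray, and the sum below has this single summand. -/
def extraMark (F : Finset (PointedCone ℝ V)) (u : PointedCone ℝ V → V)
    (σ τ : PointedCone ℝ V) : V :=
  ∑ ρ ∈ raysOf F σ \ raysOf F τ, u ρ

/-- Minkowski `k`-weights on the marked fan `(F, u)`: the balancing condition at every
`(k - 1)`-dimensional cone. Only the values of `w` on `F(k)` matter. -/
def IsMinkowskiWeight (F : Finset (PointedCone ℝ V)) (u : PointedCone ℝ V → V) (k : ℕ)
    (w : PointedCone ℝ V → ℝ) : Prop :=
  ∀ τ ∈ F, coneDim τ + 1 = k → ∑ σ ∈ cofaces F τ, w σ • extraMark F u σ τ ∈ coneSpan τ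

/-- `(F, u, w)` is a marked tropical `d`-fan: `F` is a simplicial `d`-fan, `u` is a marking of `F`
and `w` is a positive Minkowski `d`-weight on `(F, u)`. -/
structure IsTropicalFan (F : Finset (PointedCone ℝ V)) (u : PointedCone ℝ V → V)
    (w : PointedCone ℝ V → ℝ) (d : ℕ) : Prop where
  isSimplicialFan : IsSimplicialFan F
  isPureOfDim : IsPureOfDim F d
  isMarking : IsMarking F u
  isMinkowskiWeight : IsMinkowskiWeight F u d w
  pos : ∀ σ ∈ conesOfDim F d, 0 < w σ

/-- The neighborhood `N_τ F`: all faces of the cones of `F` that have `τ` as a face. -/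
def nbhd (F : Finset (PointedCone ℝ V)) (τ : PointedCone ℝ V) : Finset (PointedCone ℝ V) :=
  F.filter (fun π => ∃ σ ∈ F, τ.IsFaceOf σ ∧ π.IsFaceOf σ)

/-- The star `F^τ`, a fan in `V ⧸ V_τ`: the images of the cones in the neighborhood of `τ`. -/
def star (F : Finset (PointedCone ℝ V)) (τ : PointedCone ℝ V) :
    Finset (PointedCone ℝ (V ⧸ coneSpan τ)) :=
  (nbhd F τ).image (PointedCone.map (coneSpan τ).mkQ)

/-- The marking `u^τ` of the star: a ray `η` of `F^τ` is the image of a unique ray of `N_τ F`,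
and it is marked by the class of the mark of that ray. -/
def starMarking (F : Finset (PointedCone ℝ V)) (u : PointedCone ℝ V → V) (τ : PointedCone ℝ V) :
    PointedCone ℝ (V ⧸ coneSpan τ) → V ⧸ coneSpan τ := fun η =>
  (coneSpan τ).mkQ (u (Classical.epsilon fun ρ : PointedCone ℝ V =>
    ρ ∈ conesOfDim (nbhd F τ) 1 ∧ PointedCone.map (coneSpan τ).mkQ ρ = η))

/-- The weight `w^τ` on the star of a `d`-fan: a maximal cone of `F^τ` is the image of a unique
`d`-dimensional cone of `N_τ F`, and it gets the weight of that cone. -/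
def starWeight (F : Finset (PointedCone ℝ V)) (w : PointedCone ℝ V → ℝ) (d : ℕ)
    (τ : PointedCone ℝ V) : PointedCone ℝ (V ⧸ coneSpan τ) → ℝ := fun σ =>
  w (Classical.epsilon fun π : PointedCone ℝ V =>
    π ∈ conesOfDim (nbhd F τ) d ∧ PointedCone.map (coneSpan τ).mkQ π = σ)

/-- `F` (a `d`-fan) is unpinched: for every cone `τ` of codimension at least two, the support of
the star at `τ` stays connected after removing the origin. -/
def IsUnpinched [TopologicalSpace V] (F : Finset (PointedCone ℝ V)) (d : ℕ) : Prop :=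
  ∀ τ ∈ F, coneDim τ + 2 ≤ d → IsConnected (support (star F τ) \ {0})

end Fans

section Divisors

variable {V : Type*} [AddCommGroup V] [Module ℝ V] [TopologicalSpace V]

/-- Piecewise linear functions on `F`: continuous functions on `|F|` that agree on each cone with
a linear function. -/
def PL (F : Finset (PointedCone ℝ V)) : Submodule ℝ (support F → ℝ) where
  carrier := {φ | Continuous φ ∧
    ∀ σ ∈ F, ∃ l : Module.Dual ℝ V, ∀ x : support F, (x : V) ∈ σ → φ x = l x}
  zero_mem' := ⟨continuous_zero, fun _ _ => ⟨0, fun _ _ => rfl⟩⟩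
  add_mem' := by
    rintro φ ψ ⟨hφ, h₁⟩ ⟨hψ, h₂⟩
    refine ⟨hφ.add hψ, fun σ hσ => ?_⟩
    obtain ⟨l₁, hl₁⟩ := h₁ σ hσ
    obtain ⟨l₂, hl₂⟩ := h₂ σ hσ
    exact ⟨l₁ + l₂, fun x hx => by simp [hl₁ x hx, hl₂ x hx]⟩
  smul_mem' := by
    rintro c φ ⟨hφ, h⟩
    refine ⟨hφ.const_smul c, fun σ hσ => ?_⟩
    obtain ⟨l, hl⟩ := h σ hσ
    exact ⟨c • l, fun x hx => by simp [hl x hx]⟩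

/-- The subspace `L(F)` of linear functions, i.e. of restrictions of linear functions on `V`. -/
def linearFunctions (F : Finset (PointedCone ℝ V)) : Submodule ℝ (PL F) where
  carrier := {φ | ∃ l : Module.Dual ℝ V, ∀ x : support F, φ.1 x = l x}
  zero_mem' := ⟨0, fun _ => rfl⟩
  add_mem' := by
    rintro φ ψ ⟨l₁, h₁⟩ ⟨l₂, h₂⟩
    exact ⟨l₁ + l₂, fun x => by simp [h₁ x, h₂ x]⟩
  smul_mem' := by
    rintro c φ ⟨l, h⟩
    exact ⟨c • l, fun x => by simp [h x]⟩

/-- The vector space of divisors `D(F) = PL(F) / L(F)`. -/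
abbrev Divisor (F : Finset (PointedCone ℝ V)) : Type _ := PL F ⧸ linearFunctions F

/-- A linear function `φ_σ` on `V` that agrees with `φ` on the cone `σ` of `F`. -/
def localLinear {F : Finset (PointedCone ℝ V)} (φ : PL F) (σ : PointedCone ℝ V) :
    Module.Dual ℝ V :=
  if h : σ ∈ F then (φ.2.2 σ h).choose else 0

/-- The formula for the action of the class of `φ` on weights:
`τ ↦ ∑ φ_σ (w σ • u_{σ∖τ}) - φ_τ (∑ w σ • u_{σ∖τ})`, both sums over the `σ` that have `τ` as a
face of codimension one. -/
def actPL {F : Finset (PointedCone ℝ V)} (u : PointedCone ℝ V → V) (φ : PL F)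
    (w : PointedCone ℝ V → ℝ) : PointedCone ℝ V → ℝ := fun τ =>
  ∑ σ ∈ cofaces F τ, localLinear φ σ (w σ • extraMark F u σ τ)
    - localLinear φ τ (∑ σ ∈ cofaces F τ, w σ • extraMark F u σ τ)

/-- The action `D · w` of a divisor on a Minkowski weight, computed with a piecewise linear function
that represents `D`. It sends `k`-weights to `(k - 1)`-weights, and it depends neither on the
representative nor on the linear functions `φ_σ`, see `act_apply_eq`. -/
def act {F : Finset (PointedCone ℝ V)} (u : PointedCone ℝ V → V) (D : Divisor F)
    (w : PointedCone ℝ V → ℝ) : PointedCone ℝ V → ℝ :=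
  actPL u (Function.surjInv (linearFunctions F).mkQ_surjective D) w

/-- The mixed degree `deg (D₁ ⋯ D_d) = (D₁ ⋯ D_d · w)(0)`, where `0` is the cone `{0}`. -/
def deg {F : Finset (PointedCone ℝ V)} (u : PointedCone ℝ V → V) (w : PointedCone ℝ V → ℝ)
    (Ds : List (Divisor F)) : ℝ :=
  (Ds.foldr (act u) w) ⊥

/-- A divisor is strictly convex if, for every cone `τ` of `F`, it has a representative that
vanishes on `τ` and is strictly positive on `|N_τ F| ∖ τ`. -/
def IsStrictlyConvex {F : Finset (PointedCone ℝ V)} (D : Divisor F) : Prop :=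
  ∀ τ ∈ F, ∃ φ : PL F, (linearFunctions F).mkQ φ = D ∧
    (∀ x : support F, (x : V) ∈ τ → φ.1 x = 0) ∧
    (∀ x : support F, (x : V) ∈ support (nbhd F τ) → (x : V) ∉ τ → 0 < φ.1 x)

/-- `F` is quasiprojective if it has a strictly convex divisor. -/
def IsQuasiprojective (F : Finset (PointedCone ℝ V)) : Prop :=
  ∃ D : Divisor F, IsStrictlyConvex D

end Divisors

/-- The function `B` is a symmetric bilinear form that has exactly one positive eigenvalue, i.e.
signature `(1, q, r)`. -/
def HasOnePositiveEigenvalue {M : Type*} [AddCommGroup M] [Module ℝ M] (B : M → M → ℝ) : Prop :=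
  ∃ Φ : LinearMap.BilinForm ℝ M, (∀ x y, Φ x y = B x y) ∧ Φ.IsSymm ∧
    sigPos (LinearMap.BilinMap.toQuadraticMap Φ) = 1

section Lorentzian

variable {V : Type*} [AddCommGroup V] [Module ℝ V] [TopologicalSpace V]

/-- The marked tropical `d`-fan `(F, u, w)` is Lorentzian: `F` is quasiprojective and, for every
cone `τ` of `F`, with `d^τ = d - dim τ`, and all strictly convex divisors `D₃, …, D_{d^τ}` on the
star at `τ`, the form `(D₁, D₂) ↦ deg (D₁ D₂ D₃ ⋯ D_{d^τ})` on the divisors of the star has exactly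
one positive eigenvalue. (There is no condition at `τ` if `d^τ < 2`.) -/
def IsLorentzian (F : Finset (PointedCone ℝ V)) (u : PointedCone ℝ V → V)
    (w : PointedCone ℝ V → ℝ) (d : ℕ) : Prop :=
  IsQuasiprojective F ∧
    ∀ τ ∈ F, ∀ Ds : List (Divisor (star F τ)), coneDim τ + (Ds.length + 2) = d →
      (∀ D ∈ Ds, IsStrictlyConvex D) →
        HasOnePositiveEigenvalue fun D₁ D₂ : Divisor (star F τ) =>
          deg (starMarking F u τ) (starWeight F w d τ) (D₁ :: D₂ :: Ds)

end Lorentzian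

section WellDefined

variable {V : Type*} [AddCommGroup V] [Module ℝ V] [TopologicalSpace V]

/-- The linear functions `φ_σ` agree with `φ` on `σ`. -/
theorem localLinear_apply {F : Finset (PointedCone ℝ V)} (φ : PL F) {σ : PointedCone ℝ V}
    (h : σ ∈ F) (x : support F) (hx : (x : V) ∈ σ) : localLinear φ σ x = φ.1 x := by
  rw [localLinear, dif_pos h]
  exact ((φ.2.2 σ h).choose_spec x hx).symm

/-- The action of a divisor `D` on a weight that is balanced at `τ` may be computed with any
representative `φ` of `D` and any linear functions `l σ` that agree with `φ` on `σ`. -/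
theorem act_apply_eq {F : Finset (PointedCone ℝ V)} {u : PointedCone ℝ V → V}
    (hu : IsMarking F u) {w : PointedCone ℝ V → ℝ} {τ : PointedCone ℝ V} (hτ : τ ∈ F)
    (hw : ∑ σ ∈ cofaces F τ, w σ • extraMark F u σ τ ∈ coneSpan τ)
    (φ : PL F) (l : PointedCone ℝ V → Module.Dual ℝ V)
    (hl : ∀ σ ∈ F, ∀ x : support F, (x : V) ∈ σ → φ.1 x = l σ x) :
    act u ((linearFunctions F).mkQ φ) w τ =
      ∑ σ ∈ cofaces F τ, l σ (w σ • extraMark F u σ τ)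
        - l τ (∑ σ ∈ cofaces F τ, w σ • extraMark F u σ τ) := by
  set ψ := Function.surjInv (linearFunctions F).mkQ_surjective ((linearFunctions F).mkQ φ) with hψ
  have h1 : (linearFunctions F).mkQ ψ = (linearFunctions F).mkQ φ :=
    Function.surjInv_eq (linearFunctions F).mkQ_surjective _
  obtain ⟨m, hm⟩ := (Submodule.Quotient.eq (linearFunctions F)).1 h1
  have hm' : ∀ x : support F, ψ.1 x = φ.1 x + m x := fun x => by
    have := hm x
    simp only [Submodule.coe_sub, Pi.sub_apply] at this
    linarith
  have key : ∀ σ ∈ F, ∀ x ∈ σ, localLinear ψ σ x = l σ x + m x := fun σ hσ x hx => by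
    have hx' : x ∈ support F := Set.mem_biUnion hσ hx
    rw [localLinear_apply ψ hσ ⟨x, hx'⟩ hx, hm', hl σ hσ ⟨x, hx'⟩ hx]
  have key2 : ∀ σ ∈ F, ∀ x ∈ coneSpan σ, localLinear ψ σ x = l σ x + m x := fun σ hσ x hx => by
    have : Set.EqOn (localLinear ψ σ) (l σ + m : Module.Dual ℝ V) (σ : Set V) :=
      fun y hy => key σ hσ y hy
    exact LinearMap.eqOn_span (f := localLinear ψ σ) (g := l σ + m) this hx
  have hmem : ∀ σ ∈ cofaces F τ, extraMark F u σ τ ∈ coneSpan σ := fun σ _ => by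
    refine Submodule.sum_mem _ fun ρ hρ => ?_
    have hρ' := Finset.mem_filter.1 (Finset.mem_sdiff.1 hρ).1
    exact Submodule.subset_span (hρ'.2.le (hu ρ hρ'.1).1)
  have hF : ∀ σ ∈ cofaces F τ, σ ∈ F := fun σ hσ =>
    (Finset.mem_filter.1 (Finset.mem_filter.1 hσ).1).1
  change actPL u ψ w τ = _
  rw [actPL, key2 τ hτ _ hw,
    Finset.sum_congr rfl fun σ hσ => key2 σ (hF σ hσ) _ (Submodule.smul_mem _ _ (hmem σ hσ)),
    Finset.sum_add_distrib, map_sum m]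
  ring

end WellDefined

end LorentzianFan

end

/-! A marked simplicial fan is encoded by a simplicial complex `Δ` on its rays, with the marks as
vectors `v` (`isFanModel_rayComplex`). A piecewise linear function becomes its list of values at the
marks, the action on weights becomes a sum over link vertices (`act_divisorOf`), and the star at a
cone becomes the link of a face (`IsTropicalModel.star`). Having one positive eigenvalue is replaced
by `IsHyperbolic`, which can be tested after pulling back along the surjection onto divisors.

That (A) and (B) suffice is an induction on the number of convex divisors `D :: As`
(`isHyperbolic_degForm`). Minus a linear function, `D` vanishes on the face `t` and has positive
values `c i` at the link vertices. The form at `t` with factors `D :: As` is the sum of `c i` times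
the forms at `insert i t` with factors `As`, which are hyperbolic by induction; and row `i` of its
matrix `S` is the pairing with `D` in the form at `insert i t`. The reversed Cauchy–Schwarz
inequality in every star therefore gives `x ⬝ S x ≤ ∑ c i (S x) i ^ 2 / (S c) i`. This keeps the
eigenvalues of `S`, relative to the diagonal matrix with entries `(S c) i / c i`, out of the open
interval from 0 to 1. The off-diagonal entries of `S` are nonnegative, and positive on edges of the
link, so connectedness makes 1 the largest eigenvalue, with only the multiples of `c` as
eigenvectors. Hence `S` is nonpositive on the orthogonal complement of `c`
(`dotProduct_mulVec_nonpos_of_connected`).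

Conversely, (B) is the case without further divisors. If the link of `t` were disconnected, cutting
a convex function into its parts on the two sides would give two orthogonal vectors of positive
square, which a form with one positive eigenvalue does not allow
(`isLinkConnected_of_isHyperbolic`). Connectedness of the punctured support is that of the edge
graph (`IsFanModel.isConnected_support_iff`). -/

noncomputable section

namespace LorentzianFan

open scoped Classical

/-! ### Symmetric forms with one positive eigenvalue. -/

section Hyperbolic

variable {M N : Type*} [AddCommGroup M] [Module ℝ M] [AddCommGroup N] [Module ℝ N]

/-- A symmetric bilinear function that is positive at some vector `p` and nonpositive on the
orthogonal complement of `p`. -/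
structure IsHyperbolic (B : M → M → ℝ) : Prop where
  symm : ∀ x y, B x y = B y x
  add_left : ∀ x y z, B (x + y) z = B x z + B y z
  smul_left : ∀ (c : ℝ) x y, B (c • x) y = c * B x y
  exists_pos : ∃ p, 0 < B p p ∧ ∀ x, B x p = 0 → B x x ≤ 0

/-- The bilinear form underlying a hyperbolic function. -/
def IsHyperbolic.toBilin {B : M → M → ℝ} (h : IsHyperbolic B) : LinearMap.BilinForm ℝ M :=
  LinearMap.mk₂ ℝ B h.add_left h.smul_left
    (fun x y z => by rw [h.symm, h.add_left, h.symm y, h.symm z])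
    (fun c x y => by rw [h.symm, h.smul_left, h.symm y, smul_eq_mul])

/-- The condition only involves values of `B`, so a witness `p` can be pushed forward or lifted.
This trades divisors for their values at the marks. -/
theorem IsHyperbolic.comp_iff {B : M → M → ℝ} (f : N →ₗ[ℝ] M) (hf : Function.Surjective f) :
    IsHyperbolic (fun x y => B (f x) (f y)) ↔ IsHyperbolic B := by
  constructor
  · rintro ⟨h1, h2, h3, p, hp, h4⟩
    refine ⟨hf.forall₂.2 h1, hf.forall₃.2 fun x y z => ?_, fun c => hf.forall₂.2 fun x y => ?_,
      f p, hp, hf.forall.2 h4⟩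
    · simpa using h2 x y z
    · simpa using h3 c x y
  · rintro ⟨h1, h2, h3, p, hp, h4⟩
    obtain ⟨p, rfl⟩ := hf p
    exact ⟨fun _ _ => h1 _ _, fun _ _ _ => by simp [h2], fun _ _ _ => by simp [h3], p, hp,
      fun x => h4 _⟩

/-- A vector of positive square orthogonal to `p` would span with `p` a positive definite plane.
Conversely, a positive definite subspace of dimension at least two contains a nonzero vector
orthogonal to `p`. -/
theorem hasOnePositiveEigenvalue_iff [FiniteDimensional ℝ M] (B : M → M → ℝ) :
    HasOnePositiveEigenvalue B ↔ IsHyperbolic B := by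
  constructor
  · rintro ⟨Φ, hΦ, hs, h1⟩
    have hsymm : ∀ x y, Φ x y = Φ y x := fun x y => by simpa using hs.eq x y
    refine ⟨fun x y => by rw [← hΦ, ← hΦ, hsymm], fun x y z => by simp [← hΦ],
      fun c x y => by simp [← hΦ], ?_⟩
    obtain ⟨U, hU, hpos⟩ := exists_finrank_eq_sigPos_and_posDef (LinearMap.BilinMap.toQuadraticMap Φ)
    rw [h1] at hU
    have : Nontrivial U := Module.nontrivial_of_finrank_pos (R := ℝ) (by omega)
    obtain ⟨p, hp⟩ := exists_ne (0 : U)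
    have hpp : 0 < Φ p p := by simpa using hpos p hp
    refine ⟨p, by rw [← hΦ]; exact hpp, fun x hx => ?_⟩
    rw [← hΦ] at hx ⊢
    by_contra! hxx
    have hli : LinearIndependent ℝ ![(p : M), x] := by
      rw [LinearIndependent.pair_iff]
      intro s t hst
      have e1 : Φ (s • (p : M) + t • x) p = 0 := by rw [hst]; simp
      have e2 : Φ (s • (p : M) + t • x) x = 0 := by rw [hst]; simp
      simp only [map_add, map_smul, LinearMap.add_apply, LinearMap.smul_apply, smul_eq_mul, hx,
        hsymm p x] at e1 e2
      constructor
      · have : s * Φ p p = 0 := by linarith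
        exact (mul_eq_zero.1 this).resolve_right hpp.ne'
      · have : t * Φ x x = 0 := by linarith
        exact (mul_eq_zero.1 this).resolve_right hxx.ne'
    have hfr := finrank_span_eq_card hli
    have hpd : ((LinearMap.BilinMap.toQuadraticMap Φ).restrict
        (Submodule.span ℝ (Set.range ![(p : M), x]))).PosDef := by
      rintro ⟨y, hy⟩ hy0
      have hy' := hy
      rw [Matrix.range_cons, Matrix.range_cons, Matrix.range_empty, Set.union_empty,
        Set.singleton_union, Submodule.mem_span_pair] at hy'
      obtain ⟨s, t, rfl⟩ := hy'
      have : s ≠ 0 ∨ t ≠ 0 := by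
        by_contra! h
        exact hy0 (by simp [h.1, h.2])
      have e : Φ (s • (p : M) + t • x) (s • (p : M) + t • x) = s ^ 2 * Φ p p + t ^ 2 * Φ x x := by
        simp only [map_add, map_smul, LinearMap.add_apply, LinearMap.smul_apply, smul_eq_mul, hx,
          hsymm p x]
        ring
      change 0 < Φ (s • (p : M) + t • x) (s • (p : M) + t • x)
      rw [e]
      rcases this with h | h <;> positivity
    have := le_sigPos_of_posDef _ hpd
    rw [hfr, h1] at this
    simp at this
  · intro h
    obtain ⟨p, hp, hneg⟩ := h.exists_pos
    set Φ := h.toBilin with hΦ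
    have hB : ∀ x y, Φ x y = B x y := fun x y => rfl
    refine ⟨Φ, hB, ⟨fun x y => by simpa [hB] using h.symm x y⟩, le_antisymm ?_ ?_⟩
    · obtain ⟨U, hU, hpos⟩ :=
        exists_finrank_eq_sigPos_and_posDef (LinearMap.BilinMap.toQuadraticMap Φ)
      rw [← hU]
      by_contra! hlt
      have hker := LinearMap.ker_ne_bot_of_finrank_lt (f := (Φ.flip p).comp U.subtype)
        (by simpa using hlt)
      obtain ⟨x, hx, hx0⟩ := (Submodule.ne_bot_iff _).1 hker
      have h1 : 0 < Φ x x := by simpa using hpos x hx0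
      have h2 : B x p = 0 := by simpa [hB] using hx
      have := hneg _ h2
      rw [hB] at h1
      linarith
    · have hp0 : p ≠ 0 := by
        rintro rfl
        rw [← hB] at hp
        simp at hp
      have : ((LinearMap.BilinMap.toQuadraticMap Φ).restrict (Submodule.span ℝ {p})).PosDef := by
        rintro ⟨y, hy⟩ hy0
        obtain ⟨c, rfl⟩ := Submodule.mem_span_singleton.1 hy
        have hc : c ≠ 0 := by rintro rfl; simp at hy0
        have e : Φ (c • p) (c • p) = c ^ 2 * B p p := by
          simp [hB]; ring
        change 0 < Φ (c • p) (c • p)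
        rw [e]
        positivity
      have := le_sigPos_of_posDef _ this
      rwa [finrank_span_singleton hp0] at this

/-- The reversed Cauchy–Schwarz inequality. -/
theorem IsHyperbolic.mul_le_sq {B : M → M → ℝ} (h : IsHyperbolic B) (x : M) {q : M}
    (hq : 0 < B q q) : B x x * B q q ≤ B x q ^ 2 := by
  obtain ⟨p, hp, hneg⟩ := h.exists_pos
  have add_right : ∀ x y z, B x (y + z) = B x y + B x z := fun x y z => by
    rw [h.symm, h.add_left, h.symm y, h.symm z]
  have smul_right : ∀ (c : ℝ) x y, B x (c • y) = c * B x y := fun c x y => by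
    rw [h.symm, h.smul_left, h.symm y]
  have hqp : B q p ≠ 0 := fun h0 => by linarith [hneg q h0]
  -- This combination of `x` and `q` is orthogonal to `p`, so its square is nonpositive; multiplying
  -- by `B q q` and completing the square gives the claim.
  have hz : B (B q p • x + (-B x p) • q) p = 0 := by
    rw [h.add_left, h.smul_left, h.smul_left]; ring
  have key := hneg _ hz
  simp only [h.add_left, h.smul_left, add_right, smul_right, h.symm q x] at key
  set a := B q p
  set b := B x p
  have h1 : a ^ 2 * (B x x * B q q - B x q ^ 2) ≤ 0 := by
    nlinarith [sq_nonneg (a * B x q - b * B q q), mul_le_mul_of_nonneg_right key hq.le]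
  have : 0 < a ^ 2 := by positivity
  nlinarith

end Hyperbolic

/-! ### A Perron–Frobenius criterion by the Bochner method. -/

section Matrix

variable {n : Type*} [Fintype n]

-- In an orthonormal eigenbasis the quadratic form is the sum of eigenvalue times squared coordinate
-- of `y`; each term is nonpositive, since the eigenvalue is nonpositive or the coordinate vanishes.
open Matrix in
theorem dotProduct_mulVec_nonpos_of_eigenvector {S : Matrix n n ℝ} (hS : S.IsHermitian)
    (y : n → ℝ)
    (h : ∀ (z : n → ℝ) (l : ℝ), z ≠ 0 → S *ᵥ z = l • z → l ≤ 0 ∨ z ⬝ᵥ y = 0) :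
    y ⬝ᵥ S *ᵥ y ≤ 0 := by
  set b := hS.eigenvectorBasis with hb
  have hin : ∀ x y : n → ℝ, x ⬝ᵥ y = inner ℝ (WithLp.toLp 2 x) (WithLp.toLp 2 y) := fun x y => by
    rw [EuclideanSpace.inner_toLp_toLp, dotProduct_comm]; simp
  rw [hin, ← b.sum_inner_mul_inner]
  refine Finset.sum_nonpos fun i _ => ?_
  have hbi : WithLp.toLp 2 (⇑(b i)) = b i := rfl
  have h1 : inner ℝ (b i) (WithLp.toLp 2 (S *ᵥ y)) =
      hS.eigenvalues i * inner ℝ (b i) (WithLp.toLp 2 y) := by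
    rw [← hbi, ← hin, ← hin, dotProduct_mulVec, ← mulVec_transpose]
    have : Sᵀ = S := by simpa [IsSymm] using hS
    rw [this, hb, hS.mulVec_eigenvectorBasis]
    simp
  rw [h1, real_inner_comm (b i)]
  have h2 : inner ℝ (b i) (WithLp.toLp 2 y) = (⇑(b i) : n → ℝ) ⬝ᵥ y := by rw [hin]
  rw [real_inner_comm, real_inner_comm (b i), h2]
  rcases h (⇑(b i)) (hS.eigenvalues i) (fun h0 => b.toBasis.ne_zero i (by
      rw [OrthonormalBasis.coe_toBasis, ← hbi, h0]; rfl)) (hS.mulVec_eigenvectorBasis i) with h3 | h3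
  · nlinarith [mul_nonneg (neg_nonneg.2 h3) (mul_self_nonneg ((⇑(b i) : n → ℝ) ⬝ᵥ y))]
  · rw [h3]; simp

open Matrix in
/-- A Perron–Frobenius type criterion for a symmetric matrix to be negative semidefinite on the
orthogonal complement of a positive vector. -/
theorem dotProduct_mulVec_nonpos_of_connected (S : Matrix n n ℝ) (hS : S.IsHermitian)
    (c : n → ℝ) (hc : ∀ i, 0 < c i) (hSc : ∀ i, 0 < (S *ᵥ c) i)
    (hoff : ∀ i j, i ≠ j → 0 ≤ S i j)
    (hconn : ∀ p : n → Prop, (∃ i, p i) → (∀ i j, p i → i ≠ j → 0 < S i j → p j) → ∀ i, p i)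
    (hB : ∀ x, x ⬝ᵥ S *ᵥ x ≤ ∑ i, c i * (S *ᵥ x) i ^ 2 / (S *ᵥ c) i)
    (x : n → ℝ) (hx : x ⬝ᵥ S *ᵥ c = 0) : x ⬝ᵥ S *ᵥ x ≤ 0 := by
  have hsym : ∀ i j, S i j = S j i := fun i j => by simpa using hS.apply j i
  -- Scaling by `r` makes the eigenvectors of `T` the solutions of `S z = l r² z`; by the choice of
  -- `r`, `c` is a solution with `l = 1`.
  obtain ⟨r, hr⟩ : ∃ r : n → ℝ, r = fun i => √((S *ᵥ c) i / c i) := ⟨_, rfl⟩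
  have hr0 : ∀ i, 0 < r i := fun i => by
    rw [hr]; exact Real.sqrt_pos.2 (div_pos (hSc i) (hc i))
  have hr2 : ∀ i, r i * r i * c i = (S *ᵥ c) i := fun i => by
    rw [hr]
    simp only
    rw [Real.mul_self_sqrt (div_pos (hSc i) (hc i)).le, div_mul_cancel₀ _ (hc i).ne']
  set T : Matrix n n ℝ := fun i j => (r i)⁻¹ * S i j * (r j)⁻¹ with hT
  have hTH : T.IsHermitian := by
    ext i j
    rw [conjTranspose_apply, star_trivial]
    simp only [hT, hsym i j]; ring
  have hTmul : ∀ (z : n → ℝ) i, (T *ᵥ (fun j => r j * z j)) i = (r i)⁻¹ * (S *ᵥ z) i := by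
    intro z i
    simp only [mulVec, dotProduct, hT, Finset.mul_sum]
    refine Finset.sum_congr rfl fun j _ => ?_
    have := (hr0 j).ne'
    field_simp
  have hTq : ∀ z : n → ℝ, (fun j => r j * z j) ⬝ᵥ T *ᵥ (fun j => r j * z j) = z ⬝ᵥ S *ᵥ z := by
    intro z
    simp only [dotProduct, hTmul]
    refine Finset.sum_congr rfl fun j _ => ?_
    have := (hr0 j).ne'
    field_simp
  rw [← hTq]
  refine dotProduct_mulVec_nonpos_of_eigenvector hTH _ fun z' l hz0 hz => ?_
  obtain ⟨z, rfl⟩ : ∃ z : n → ℝ, z' = fun j => r j * z j :=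
    ⟨fun j => (r j)⁻¹ * z' j, funext fun j => by have := (hr0 j).ne'; field_simp⟩
  have hSz : ∀ i, (S *ᵥ z) i = l * (r i * r i * z i) := fun i => by
    have h1 := congrFun hz i
    rw [hTmul] at h1
    simp only [Pi.smul_apply, smul_eq_mul] at h1
    have := (hr0 i).ne'
    field_simp at h1
    linarith
  set g := ∑ i, r i * r i * (z i * z i) with hg
  have hgpos : 0 < g := by
    refine Finset.sum_pos' (fun i _ =>
      mul_nonneg (mul_self_nonneg _) (mul_self_nonneg _)) ?_
    obtain ⟨i, hi⟩ := Function.ne_iff.1 hz0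
    have hzi : z i ≠ 0 := fun h0 => hi (by simp [h0])
    refine ⟨i, Finset.mem_univ _, ?_⟩
    have := hr0 i
    have := mul_self_pos.2 hzi
    positivity
  have hq : z ⬝ᵥ S *ᵥ z = l * g := by
    simp only [dotProduct, hSz, hg, Finset.mul_sum]
    exact Finset.sum_congr rfl fun i _ => by ring
  -- Evaluated at an eigenvector, `hB` excludes eigenvalues strictly between 0 and 1.
  have hll : l * g ≤ l ^ 2 * g := by
    rw [← hq]
    refine (hB z).trans (le_of_eq ?_)
    rw [hg, Finset.mul_sum]
    refine Finset.sum_congr rfl fun i _ => ?_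
    rw [hSz, ← hr2]
    have := (hr0 i).ne'
    have := (hc i).ne'
    field_simp
  have hl : l ≤ l ^ 2 := le_of_mul_le_mul_right hll hgpos
  by_cases hl0 : l ≤ 0
  · exact Or.inl hl0
  right
  have hl1 : 1 ≤ l := by nlinarith
  -- the Dirichlet form of `z / c`
  have hdir : ∑ i, ∑ j, S i j * c i * c j * (z i / c i - z j / c j) ^ 2 = 2 * g - 2 * (l * g) := by
    have e : ∀ i j, S i j * c i * c j * (z i / c i - z j / c j) ^ 2 =
        (z i * z i / c i) * (S i j * c j) + (z j * z j / c j) * (S i j * c i)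
          - 2 * (z i * (S i j * z j)) := fun i j => by
      have := (hc i).ne'
      have := (hc j).ne'
      field_simp
      ring
    have e1 : ∑ i, ∑ j, (z i * z i / c i) * (S i j * c j) = g := by
      rw [hg]
      refine Finset.sum_congr rfl fun i _ => ?_
      rw [← Finset.mul_sum]
      change z i * z i / c i * (S *ᵥ c) i = _
      rw [← hr2]
      have := (hc i).ne'
      field_simp
    have e2 : ∑ i, ∑ j, (z j * z j / c j) * (S i j * c i) = g := by
      rw [Finset.sum_comm, ← e1]
      exact Finset.sum_congr rfl fun i _ => Finset.sum_congr rfl fun j _ => by rw [hsym]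
    have e3 : ∑ i, ∑ j, 2 * (z i * (S i j * z j)) = 2 * (l * g) := by
      rw [← hq]
      simp only [dotProduct, mulVec, Finset.mul_sum]
    simp only [e, Finset.sum_sub_distrib, Finset.sum_add_distrib, e1, e2, e3]
    ring
  have hterm : ∀ i j, 0 ≤ S i j * c i * c j * (z i / c i - z j / c j) ^ 2 := fun i j => by
    rcases eq_or_ne i j with rfl | hij
    · simp
    · have := hoff i j hij
      have := hc i
      have := hc j
      positivity
  -- For `l ≥ 1` the Dirichlet form is nonpositive although all its terms are nonnegative.
  have hzero : ∀ i j, S i j * c i * c j * (z i / c i - z j / c j) ^ 2 = 0 := by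
    have h0 : ∑ i, ∑ j, S i j * c i * c j * (z i / c i - z j / c j) ^ 2 = 0 :=
      le_antisymm (by rw [hdir]; nlinarith)
        (Finset.sum_nonneg fun i _ => Finset.sum_nonneg fun j _ => hterm i j)
    intro i j
    have h1 := (Finset.sum_eq_zero_iff_of_nonneg
      (fun i _ => Finset.sum_nonneg fun j _ => hterm i j)).1 h0 i (Finset.mem_univ _)
    exact (Finset.sum_eq_zero_iff_of_nonneg (fun j _ => hterm i j)).1 h1 j (Finset.mem_univ _)
  obtain ⟨i0, -⟩ := Function.ne_iff.1 hz0
  -- The ratio `z / c` is constant along positive entries of `S`, hence constant.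
  have hall := hconn (fun i => z i / c i = z i0 / c i0) ⟨i0, rfl⟩ (fun i j hi hij hpos => by
    have h1 := hzero i j
    have := hc i
    have := hc j
    have h2 : (z i / c i - z j / c j) ^ 2 = 0 :=
      (mul_eq_zero.1 h1).resolve_left (by positivity)
    have := pow_eq_zero_iff (two_ne_zero) |>.1 h2
    change z j / c j = _
    change z i / c i = _ at hi
    linarith)
  have hzc : ∀ i, z i = z i0 / c i0 * c i := fun i => by
    have := hall i
    rw [← this, div_mul_cancel₀ _ (hc i).ne']
  -- A multiple of `c` pairs with `x`, after scaling, as `S c` does, which gives zero by `hx`.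
  calc (fun j => r j * z j) ⬝ᵥ (fun j => r j * x j)
      = z i0 / c i0 * (x ⬝ᵥ S *ᵥ c) := by
        simp only [dotProduct, Finset.mul_sum]
        refine Finset.sum_congr rfl fun i _ => ?_
        rw [hzc i, ← hr2]
        ring
    _ = 0 := by rw [hx, mul_zero]

end Matrix

/-! ### Linear functions with prescribed values at independent vectors. -/

section Extension

variable {ι V : Type*} [AddCommGroup V] [Module ℝ V]

/-- Extensions are chosen only for the indicator functions and then combined: this makes the result
linear in `a` and independent of the values outside `s`. -/
theorem exists_extension {v : ι → V} {s : Finset ι} (h : LinearIndepOn ℝ v (s : Set ι)) :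
    ∃ E : (ι → ℝ) →ₗ[ℝ] Module.Dual ℝ V, (∀ a, ∀ j ∈ s, E a (v j) = a j) ∧
      ∀ a b, (∀ j ∈ s, a j = b j) → E a = E b := by
  have hex : ∀ a : ι → ℝ, ∃ l : Module.Dual ℝ V, ∀ j ∈ s, l (v j) = a j := fun a => by
    obtain ⟨g, hg⟩ := LinearMap.exists_extend
      ((Module.Basis.span h).constr ℝ fun j : (s : Set ι) => a j)
    refine ⟨g, fun j hj => ?_⟩
    have h1 := LinearMap.congr_fun hg (Module.Basis.span h ⟨j, hj⟩)
    rw [Module.Basis.constr_basis] at h1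
    have h2 := Module.Basis.span_apply h ⟨j, hj⟩
    change g (Module.Basis.span h ⟨j, hj⟩ : V) = a j at h1
    rwa [h2] at h1
  choose l hl using fun i : ι => hex (Pi.single i 1)
  refine ⟨∑ i ∈ s, (LinearMap.proj i).smulRight (l i), fun a j hj => ?_, fun a b hab => ?_⟩
  · simp only [LinearMap.sum_apply, LinearMap.smulRight_apply, LinearMap.proj_apply,
      LinearMap.smul_apply, smul_eq_mul]
    rw [Finset.sum_eq_single j]
    · rw [hl j j hj]; simp
    · intro i _ hij
      rw [hl i j hj]; simp [hij.symm]
    · exact fun h => absurd hj h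
  · simp only [LinearMap.sum_apply, LinearMap.smulRight_apply, LinearMap.proj_apply]
    exact Finset.sum_congr rfl fun j hj => by rw [hab j hj]

/-- A linear function on `V` with prescribed values at the vectors `v j`, `j ∈ s`, which depends
linearly on these values. -/
def extension (v : ι → V) (s : Finset ι) : (ι → ℝ) →ₗ[ℝ] Module.Dual ℝ V :=
  -- The default `0` keeps `extension_congr` free of an independence hypothesis.
  if h : LinearIndepOn ℝ v (s : Set ι) then (exists_extension h).choose else 0

theorem extension_congr (v : ι → V) {s : Finset ι} {a b : ι → ℝ} (hab : ∀ j ∈ s, a j = b j) :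
    extension v s a = extension v s b := by
  rw [extension]
  split_ifs with h
  · exact (exists_extension h).choose_spec.2 a b hab
  · rfl

theorem extension_eq_zero (v : ι → V) {s : Finset ι} {a : ι → ℝ} (ha : ∀ j ∈ s, a j = 0) :
    extension v s a = 0 := by
  rw [extension_congr v (b := 0) ha, map_zero]

/-- The value of `a` at `i` after subtracting the linear function that agrees with `a` on `s`. -/
def residue (v : ι → V) (s : Finset ι) (i : ι) : (ι → ℝ) →ₗ[ℝ] ℝ :=
  LinearMap.proj i - (LinearMap.applyₗ (v i)).comp (extension v s)

theorem residue_apply (v : ι → V) (s : Finset ι) (i : ι) (a : ι → ℝ) :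
    residue v s i a = a i - extension v s a (v i) := rfl

theorem residue_of_eq_zero (v : ι → V) {s : Finset ι} {a : ι → ℝ} (ha : ∀ j ∈ s, a j = 0) (i : ι) :
    residue v s i a = a i := by
  rw [residue_apply, extension_eq_zero v ha]; simp

end Extension

/-! ### Weights and piecewise linear functions on a simplicial complex. -/

section Complex

variable {ι V : Type*} [Fintype ι] [AddCommGroup V] [Module ℝ V]

/-- A finite simplicial complex `Δ` on `ι` together with vectors `v i` such that the geometric
realization of `Δ` embeds into `V`: this is the same as a simplicial fan with marked rays. -/
structure IsFanComplex (Δ : Finset (Finset ι)) (v : ι → V) : Prop where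
  down_closed : ∀ s ∈ Δ, ∀ t ⊆ s, t ∈ Δ
  inj : ∀ s ∈ Δ, ∀ t ∈ Δ, ∀ a b : ι → ℝ, (∀ i, 0 ≤ a i) → (∀ i, 0 ≤ b i) →
    (∀ i ∉ s, a i = 0) → (∀ i ∉ t, b i = 0) → ∑ i, a i • v i = ∑ i, b i • v i → a = b

/-- The vertices of the link of `s`. -/
def linkVertices (Δ : Finset (Finset ι)) (s : Finset ι) : Finset ι :=
  Finset.univ.filter fun i => i ∉ s ∧ insert i s ∈ Δ

theorem mem_linkVertices {Δ : Finset (Finset ι)} {s : Finset ι} {i : ι} :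
    i ∈ linkVertices Δ s ↔ i ∉ s ∧ insert i s ∈ Δ := by simp [linkVertices]

/-- The balancing condition of Minkowski `k`-weights in terms of a complex. -/
def IsBalanced (Δ : Finset (Finset ι)) (v : ι → V) (k : ℕ) (w : Finset ι → ℝ) : Prop :=
  ∀ s ∈ Δ, s.card + 1 = k →
    ∑ i ∈ linkVertices Δ s, w (insert i s) • v i ∈ Submodule.span ℝ (v '' s)

/-- A marked tropical `d`-fan in terms of a complex. -/
structure IsTropicalComplex (Δ : Finset (Finset ι)) (v : ι → V) (W : Finset ι → ℝ) (d : ℕ) : Prop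
    extends IsFanComplex Δ v where
  exists_facet : ∀ s ∈ Δ, ∃ t ∈ Δ, s ⊆ t ∧ t.card = d
  card_le : ∀ s ∈ Δ, s.card ≤ d
  balanced : IsBalanced Δ v d W
  pos : ∀ s ∈ Δ, s.card = d → 0 < W s

/-- The positive and negative parts of a linear relation are two nonnegative combinations with the
same sum, so `inj` with both faces equal to `s` identifies them. -/
theorem IsFanComplex.linearIndepOn {Δ : Finset (Finset ι)} {v : ι → V} (h : IsFanComplex Δ v)
    {s : Finset ι} (hs : s ∈ Δ) : LinearIndepOn ℝ v (s : Set ι) := by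
  rw [linearIndepOn_finset_iff]
  intro c hc i hi
  have hsupp : ∀ f : ι → ℝ, (∀ i ∉ s, f i = 0) → ∑ i, f i • v i = ∑ i ∈ s, f i • v i :=
    fun f hf => (Finset.sum_subset (Finset.subset_univ s) fun i _ hi => by simp [hf i hi]).symm
  have key := h.inj s hs s hs (fun i => if i ∈ s then (c i)⁺ else 0)
    (fun i => if i ∈ s then (c i)⁻ else 0)
    (fun i => by split_ifs <;> simp [posPart_nonneg])
    (fun i => by split_ifs <;> simp [negPart_nonneg])
    (fun i hi => by simp [hi]) (fun i hi => by simp [hi]) (by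
      rw [hsupp _ (fun i hi => by simp [hi]), hsupp _ (fun i hi => by simp [hi]), ← sub_eq_zero,
        ← Finset.sum_sub_distrib, ← hc]
      refine Finset.sum_congr rfl fun i hi => ?_
      simp only [hi, if_true]
      rw [← sub_smul, posPart_sub_negPart])
  have h1 := congrFun key i
  simp only [hi, if_true] at h1
  rw [← posPart_sub_negPart (c i), h1, sub_self]

theorem IsFanComplex.extension_apply {Δ : Finset (Finset ι)} {v : ι → V} (h : IsFanComplex Δ v)
    {s : Finset ι} (hs : s ∈ Δ) (a : ι → ℝ) {j : ι} (hj : j ∈ s) :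
    extension v s a (v j) = a j := by
  rw [extension, dif_pos (h.linearIndepOn hs)]
  exact (exists_extension (h.linearIndepOn hs)).choose_spec.1 a j hj

/-- The action of the piecewise linear function with values `a` on weights. -/
def weightAct (Δ : Finset (Finset ι)) (v : ι → V) (a : ι → ℝ) (w : Finset ι → ℝ) :
    Finset ι → ℝ := fun s =>
  ∑ i ∈ linkVertices Δ s, residue v s i a * w (insert i s)

variable {Δ : Finset (Finset ι)} {v : ι → V}

/-- Two linear functions with the same values on `s` differ by one that kills the span of `s`, and
that span contains the balancing vector. So `extension` may be replaced by any other choice. -/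
theorem weightAct_eq (h : IsFanComplex Δ v) {s : Finset ι} (hs : s ∈ Δ) {w : Finset ι → ℝ}
    (hw : ∑ i ∈ linkVertices Δ s, w (insert i s) • v i ∈ Submodule.span ℝ (v '' s))
    (a : ι → ℝ) (l : Module.Dual ℝ V) (hl : ∀ j ∈ s, l (v j) = a j) :
    weightAct Δ v a w s = ∑ i ∈ linkVertices Δ s, (a i - l (v i)) * w (insert i s) := by
  have h0 : (extension v s a - l) (∑ i ∈ linkVertices Δ s, w (insert i s) • v i) = 0 := by
    have : Submodule.span ℝ (v '' s) ≤ LinearMap.ker (extension v s a - l) := by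
      rw [Submodule.span_le]
      rintro _ ⟨j, hj, rfl⟩
      simp [h.extension_apply hs a hj, hl j hj]
    exact this hw
  rw [weightAct, ← sub_eq_zero, ← Finset.sum_sub_distrib, ← neg_eq_zero, ← h0, map_sum,
    ← Finset.sum_neg_distrib]
  refine Finset.sum_congr rfl fun i _ => ?_
  simp [residue_apply]
  ring

/-- The action depends only on the divisor class; this permits normalizing functions to vanish on a
face. -/
theorem weightAct_sub_linear (h : IsFanComplex Δ v) {s : Finset ι} (hs : s ∈ Δ)
    {w : Finset ι → ℝ}
    (hw : ∑ i ∈ linkVertices Δ s, w (insert i s) • v i ∈ Submodule.span ℝ (v '' s))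
    (a : ι → ℝ) (l : Module.Dual ℝ V) :
    weightAct Δ v (fun i => a i - l (v i)) w s = weightAct Δ v a w s := by
  rw [weightAct_eq h hs hw _ (extension v s a - l) fun j hj => by
    simp [h.extension_apply hs a hj], weightAct]
  refine Finset.sum_congr rfl fun i _ => ?_
  simp [residue_apply]

theorem weightAct_congr (a : ι → ℝ) {s : Finset ι} {w w' : Finset ι → ℝ}
    (hw : ∀ i ∈ linkVertices Δ s, w (insert i s) = w' (insert i s)) :
    weightAct Δ v a w s = weightAct Δ v a w' s :=
  Finset.sum_congr rfl fun i hi => by rw [hw i hi]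

theorem weightAct_single {s : Finset ι} {i : ι} (hi : i ∉ s) (w : Finset ι → ℝ) :
    weightAct Δ v (Pi.single i 1) w s = if i ∈ linkVertices Δ s then w (insert i s) else 0 := by
  have h1 : ∀ k, residue v s k (Pi.single i 1) = (Pi.single i 1 : ι → ℝ) k := fun k =>
    residue_of_eq_zero v (fun j hj => Pi.single_eq_of_ne (by rintro rfl; exact hi hj) _) k
  simp only [weightAct, h1, Pi.single_apply, ite_mul, one_mul, zero_mul, Finset.sum_ite_eq']

/-- Ordered edges of the link are symmetric; stated in the form that exchanging two dependent sums
requires. -/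
theorem linkVertices_swap {s : Finset ι} (h : IsFanComplex Δ v) (i j : ι) :
    i ∈ linkVertices Δ s ∧ j ∈ linkVertices Δ (insert i s) ↔
      i ∈ linkVertices Δ (insert j s) ∧ j ∈ linkVertices Δ s := by
  simp only [mem_linkVertices, Finset.mem_insert, not_or, Finset.insert_comm i j s]
  constructor
  · rintro ⟨⟨h1, -⟩, ⟨h3, h4⟩, h5⟩
    exact ⟨⟨⟨fun e => h3 e.symm, h1⟩, h5⟩, h4, h.down_closed _ h5 _
      (Finset.insert_subset_insert _ (Finset.subset_insert _ _))⟩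
  · rintro ⟨⟨⟨h1, h2⟩, h5⟩, h3, -⟩
    exact ⟨⟨h2, h.down_closed _ h5 _ (Finset.subset_insert _ _)⟩, ⟨fun e => h1 e.symm, h3⟩, h5⟩

/-- The action on faces of the form `insert i s` of functions that vanish on `s`. -/
theorem exists_weightAct_insert_eq (h : IsFanComplex Δ v) {s : Finset ι} {w : Finset ι → ℝ}
    (hw : IsBalanced Δ v (s.card + 2) w) :
    ∃ c : ι → ℝ, ∀ i ∈ linkVertices Δ s,
      (∀ b : ι → ℝ, (∀ j ∈ s, b j = 0) → weightAct Δ v b w (insert i s) =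
        ∑ j ∈ linkVertices Δ (insert i s), b j * w (insert j (insert i s)) - b i * c i) ∧
      ∑ j ∈ linkVertices Δ (insert i s), w (insert j (insert i s)) • v j - c i • v i ∈
        Submodule.span ℝ (v '' s) := by
  -- `l i` is 1 at `v i` and 0 on `s`, so on the balancing vector at `insert i s` it reads off the
  -- coefficient of `v i` modulo the span of `s`.
  set l : ι → Module.Dual ℝ V := fun i => extension v (insert i s) (Pi.single i 1) with hl
  refine ⟨fun i => l i (∑ j ∈ linkVertices Δ (insert i s), w (insert j (insert i s)) • v j),
    fun i hi => ?_⟩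
  obtain ⟨his, hi⟩ := mem_linkVertices.1 hi
  have hwi := hw _ hi (by rw [Finset.card_insert_of_notMem his])
  have hli : l i (v i) = 1 := by
    rw [hl]; simp [h.extension_apply hi _ (Finset.mem_insert_self i s)]
  have hlj : ∀ j ∈ s, l i (v j) = 0 := fun j hj => by
    have : j ≠ i := fun e => his (e ▸ hj)
    rw [hl]; simp [h.extension_apply hi _ (Finset.mem_insert_of_mem hj), this]
  constructor
  · intro b hb
    rw [weightAct_eq h hi hwi b (b i • l i) fun j hj => by
      rcases Finset.mem_insert.1 hj with rfl | hj
      · simp [hli]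
      · simp [hlj j hj, hb j hj]]
    simp only [sub_mul, Finset.sum_sub_distrib, map_sum, Finset.mul_sum]
    congr 1
    refine Finset.sum_congr rfl fun j _ => ?_
    simp
    ring
  · rw [Finset.coe_insert, Set.image_insert_eq, Submodule.mem_span_insert] at hwi
    obtain ⟨r, z, hz, hrz⟩ := hwi
    have hlz : l i z = 0 := by
      have : Submodule.span ℝ (v '' s) ≤ LinearMap.ker (l i) := by
        rw [Submodule.span_le]
        rintro _ ⟨j, hj, rfl⟩
        exact hlj j hj
      exact this hz
    have : l i (∑ j ∈ linkVertices Δ (insert i s), w (insert j (insert i s)) • v j) = r := by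
      rw [hrz, map_add, hlz, map_smul, hli]; simp
    simp only [this]
    rw [hrz, add_sub_cancel_left]
    exact hz

/-- For `a` normalized to vanish on `s`, exchanging the double sum regroups the balancing vector at
`s` as a combination, with coefficients `b i`, of the vectors that `exists_weightAct_insert_eq` puts
in the span of `s`. -/
theorem IsBalanced.weightAct (h : IsFanComplex Δ v) {k : ℕ} {w : Finset ι → ℝ}
    (hw : IsBalanced Δ v (k + 1) w) (a : ι → ℝ) : IsBalanced Δ v k (weightAct Δ v a w) := by
  rintro s hs rfl
  obtain ⟨c, hc⟩ := exists_weightAct_insert_eq h (s := s) hw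
  set b : ι → ℝ := fun i => a i - extension v s a (v i) with hb
  have hb0 : ∀ j ∈ s, b j = 0 := fun j hj => by simp [hb, h.extension_apply hs a hj]
  have e1 : ∀ i ∈ linkVertices Δ s, LorentzianFan.weightAct Δ v a w (insert i s) • v i =
      ∑ j ∈ linkVertices Δ (insert i s), (b j * w (insert j (insert i s))) • v i
        - (b i * c i) • v i := fun i hi => by
    obtain ⟨his, hi'⟩ := mem_linkVertices.1 hi
    rw [← weightAct_sub_linear h hi' (hw _ hi' (by rw [Finset.card_insert_of_notMem his])) a
      (extension v s a), (hc i hi).1 b hb0, sub_smul, Finset.sum_smul]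
  rw [Finset.sum_congr rfl e1, Finset.sum_sub_distrib,
    Finset.sum_comm' (fun i j => linkVertices_swap h i j), ← Finset.sum_sub_distrib]
  refine Submodule.sum_mem _ fun i hi => ?_
  have := Submodule.smul_mem _ (b i) (hc i hi).2
  rw [smul_sub, Finset.smul_sum] at this
  convert this using 2
  · refine Finset.sum_congr rfl fun j _ => ?_
    rw [smul_smul, Finset.insert_comm]
  · rw [smul_smul]

/-- After normalization on `s`, a double action is a sum over ordered edges of the link minus a
diagonal term; both are symmetric in the two functions. -/
theorem weightAct_comm (h : IsFanComplex Δ v) {s : Finset ι} (hs : s ∈ Δ) {w : Finset ι → ℝ}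
    (hw : IsBalanced Δ v (s.card + 2) w) (a b : ι → ℝ) :
    weightAct Δ v a (weightAct Δ v b w) s = weightAct Δ v b (weightAct Δ v a w) s := by
  obtain ⟨c, hc⟩ := exists_weightAct_insert_eq h hw
  have key : ∀ a b : ι → ℝ, weightAct Δ v a (weightAct Δ v b w) s =
      ∑ i ∈ linkVertices Δ s, ∑ j ∈ linkVertices Δ (insert i s),
        residue v s i a * residue v s j b * w (insert j (insert i s))
        - ∑ i ∈ linkVertices Δ s, residue v s i a * residue v s i b * c i := by
    intro a b
    rw [weightAct, ← Finset.sum_sub_distrib]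
    refine Finset.sum_congr rfl fun i hi => ?_
    obtain ⟨his, hi'⟩ := mem_linkVertices.1 hi
    rw [← weightAct_sub_linear h hi' (hw _ hi' (by rw [Finset.card_insert_of_notMem his])) b
      (extension v s b), (hc i hi).1 _ (fun j hj => by simp [h.extension_apply hs b hj]), mul_sub,
      Finset.mul_sum]
    congr 1
    · exact Finset.sum_congr rfl fun j _ => by rw [residue_apply v s j b]; ring
    · rw [residue_apply v s i b]; ring
  rw [key, key, Finset.sum_comm' (fun i j => linkVertices_swap h i j)]
  congr 1
  · refine Finset.sum_congr rfl fun i _ => Finset.sum_congr rfl fun j _ => ?_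
    rw [Finset.insert_comm]
    ring
  · exact Finset.sum_congr rfl fun i _ => by ring

/-- Strict convexity, around the face `t`, of the piecewise linear function with values `a`. -/
def IsConvexAt (Δ : Finset (Finset ι)) (v : ι → V) (t : Finset ι) (a : ι → ℝ) : Prop :=
  ∀ s ∈ Δ, t ⊆ s → ∃ l : Module.Dual ℝ V, (∀ j ∈ s, l (v j) = a j) ∧
    ∀ i ∈ linkVertices Δ s, l (v i) < a i

theorem IsConvexAt.mono {s t : Finset ι} {a : ι → ℝ} (h : IsConvexAt Δ v t a) (hst : t ⊆ s) :
    IsConvexAt Δ v s a := fun r hr hsr => h r hr (hst.trans hsr)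

/-- The link of `t` is nonempty and has a connected `1`-skeleton. -/
def IsLinkConnected (Δ : Finset (Finset ι)) (t : Finset ι) : Prop :=
  (linkVertices Δ t).Nonempty ∧
  ∀ p : ι → Prop, (∃ i ∈ linkVertices Δ t, p i) →
    (∀ i ∈ linkVertices Δ t, ∀ j ∈ linkVertices Δ (insert i t), p i → p j) →
      ∀ i ∈ linkVertices Δ t, p i

/-! ### Mixed degrees, and the induction on the number of divisors. -/

section Degree

variable {W : Finset ι → ℝ} {d : ℕ}

/-- The product of piecewise linear functions and a weight. -/
def weightProd (Δ : Finset (Finset ι)) (v : ι → V) (W : Finset ι → ℝ) (As : List (ι → ℝ)) :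
    Finset ι → ℝ :=
  As.foldr (weightAct Δ v) W

theorem weightProd_cons (a : ι → ℝ) (As : List (ι → ℝ)) :
    weightProd Δ v W (a :: As) = weightAct Δ v a (weightProd Δ v W As) := rfl

theorem isBalanced_weightProd (h : IsTropicalComplex Δ v W d) (As : List (ι → ℝ)) :
    ∀ k, k + As.length = d → IsBalanced Δ v k (weightProd Δ v W As) := by
  induction As with
  | nil => rintro k rfl; exact h.balanced
  | cons a As ih =>
    intro k hk
    exact (ih (k + 1) (by rw [← hk, List.length_cons]; ring)).weightAct h.toIsFanComplex a

theorem weightProd_swap (h : IsTropicalComplex Δ v W d) {t : Finset ι} (ht : t ∈ Δ) (a b : ι → ℝ)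
    (As : List (ι → ℝ)) (hd : t.card + 2 + As.length = d) :
    weightProd Δ v W (a :: b :: As) t = weightProd Δ v W (b :: a :: As) t :=
  weightAct_comm h.toIsFanComplex ht (isBalanced_weightProd h As _ hd) a b

theorem linkVertices_nonempty (h : IsTropicalComplex Δ v W d) {t : Finset ι} (ht : t ∈ Δ)
    (hd : t.card < d) : (linkVertices Δ t).Nonempty := by
  obtain ⟨s, hs, hts, hcard⟩ := h.exists_facet t ht
  obtain ⟨i, his, hit⟩ := Finset.exists_mem_notMem_of_card_lt_card (hcard ▸ hd)
  exact ⟨i, mem_linkVertices.2 ⟨hit, h.down_closed s hs _ (Finset.insert_subset his hts)⟩⟩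

theorem exists_pos_weightAct_eq (h : IsFanComplex Δ v) {t : Finset ι} (ht : t ∈ Δ) {a : ι → ℝ}
    (ha : IsConvexAt Δ v t a) {w : Finset ι → ℝ}
    (hw : ∑ i ∈ linkVertices Δ t, w (insert i t) • v i ∈ Submodule.span ℝ (v '' t)) :
    ∃ c : ι → ℝ, (∀ i ∈ linkVertices Δ t, 0 < c i) ∧
      weightAct Δ v a w t = ∑ i ∈ linkVertices Δ t, c i * w (insert i t) := by
  obtain ⟨l, hl, hpos⟩ := ha t ht subset_rfl
  exact ⟨fun i => a i - l (v i), fun i hi => sub_pos.2 (hpos i hi), weightAct_eq h ht hw a l hl⟩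

/-- A convex factor turns the value at `t` into a positive combination of values at larger faces,
where the remaining factors are still convex; the recursion ends at the positive weights of facets.
Purity keeps the sums nonempty. -/
theorem weightProd_pos (h : IsTropicalComplex Δ v W d) (As : List (ι → ℝ)) :
    ∀ t ∈ Δ, t.card + As.length = d → (∀ a ∈ As, IsConvexAt Δ v t a) →
      0 < weightProd Δ v W As t := by
  induction As with
  | nil => exact fun t ht hd _ => h.pos t ht hd
  | cons a As ih =>
    intro t ht hd hconv
    rw [List.length_cons] at hd
    obtain ⟨c, hc, hsum⟩ := exists_pos_weightAct_eq h.toIsFanComplex ht (hconv a (by simp))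
      (isBalanced_weightProd h As (t.card + 1) (by omega) t ht rfl)
    rw [weightProd_cons, hsum]
    refine Finset.sum_pos (fun i hi => mul_pos (hc i hi) ?_)
      (linkVertices_nonempty h ht (by omega))
    obtain ⟨hit, hi⟩ := mem_linkVertices.1 hi
    exact ih _ hi (by rw [Finset.card_insert_of_notMem hit]; omega) fun b hb =>
      (hconv b (by simp [hb])).mono (Finset.subset_insert i t)

/-- The form `(x, y) ↦ deg (x y a₃ ⋯)` at the face `t`. -/
def degForm (Δ : Finset (Finset ι)) (v : ι → V) (W : Finset ι → ℝ) (t : Finset ι)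
    (As : List (ι → ℝ)) (x y : ι → ℝ) : ℝ :=
  weightProd Δ v W (x :: y :: As) t

theorem degForm_eq_sum {t : Finset ι} (As : List (ι → ℝ)) (x y : ι → ℝ) :
    degForm Δ v W t As x y = ∑ i ∈ linkVertices Δ t,
      residue v t i x * weightProd Δ v W (y :: As) (insert i t) := rfl

theorem degForm_symm (h : IsTropicalComplex Δ v W d) {t : Finset ι} (ht : t ∈ Δ)
    (As : List (ι → ℝ)) (hd : t.card + 2 + As.length = d) (x y : ι → ℝ) :
    degForm Δ v W t As x y = degForm Δ v W t As y x :=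
  weightProd_swap h ht x y As hd

theorem degForm_add_left {t : Finset ι} (As : List (ι → ℝ)) (x y z : ι → ℝ) :
    degForm Δ v W t As (x + y) z = degForm Δ v W t As x z + degForm Δ v W t As y z := by
  simp [degForm_eq_sum, add_mul, Finset.sum_add_distrib]

theorem degForm_smul_left {t : Finset ι} (As : List (ι → ℝ)) (c : ℝ) (x y : ι → ℝ) :
    degForm Δ v W t As (c • x) y = c * degForm Δ v W t As x y := by
  simp [degForm_eq_sum, mul_assoc, Finset.mul_sum]

theorem degForm_single {t : Finset ι} {i : ι} (hi : i ∈ linkVertices Δ t) (As : List (ι → ℝ))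
    (y : ι → ℝ) :
    degForm Δ v W t As (Pi.single i 1) y = weightProd Δ v W (y :: As) (insert i t) := by
  rw [degForm, weightProd_cons, weightAct_single (mem_linkVertices.1 hi).1, if_pos hi]

theorem degForm_single_single {t : Finset ι} {i j : ι} (hi : i ∈ linkVertices Δ t)
    (hj : j ∉ insert i t) (As : List (ι → ℝ)) :
    degForm Δ v W t As (Pi.single i 1) (Pi.single j 1) =
      if j ∈ linkVertices Δ (insert i t) then weightProd Δ v W As (insert j (insert i t))
        else 0 := by
  rw [degForm_single hi, weightProd_cons, weightAct_single hj]

/-- The form sees only the residues at link vertices, so a finite matrix describes it. -/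
theorem degForm_eq_double_sum (h : IsTropicalComplex Δ v W d) {t : Finset ι} (ht : t ∈ Δ)
    (As : List (ι → ℝ)) (hd : t.card + 2 + As.length = d) (x y : ι → ℝ) :
    degForm Δ v W t As x y = ∑ i ∈ linkVertices Δ t, residue v t i x *
      ∑ j ∈ linkVertices Δ t, degForm Δ v W t As (Pi.single i 1) (Pi.single j 1) *
        residue v t j y := by
  rw [degForm_eq_sum]
  refine Finset.sum_congr rfl fun i hi => ?_
  rw [← degForm_single hi, degForm_symm h ht As hd, degForm_eq_sum]
  congr 1
  refine Finset.sum_congr rfl fun j hj => ?_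
  rw [← degForm_single hj, degForm_symm h ht As hd, mul_comm]

/-- The forms at codimension two faces being hyperbolic and connectivity of the links imply that
all degree forms are hyperbolic. -/
theorem isHyperbolic_degForm (h : IsTropicalComplex Δ v W d)
    (hconn : ∀ t ∈ Δ, t.card + 2 ≤ d → IsLinkConnected Δ t)
    (hbase : ∀ t ∈ Δ, t.card + 2 = d → IsHyperbolic (degForm Δ v W t []))
    (As : List (ι → ℝ)) :
    ∀ t ∈ Δ, t.card + 2 + As.length = d → (∀ a ∈ As, IsConvexAt Δ v t a) →
      IsHyperbolic (degForm Δ v W t As) := by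
  induction As with
  | nil => exact fun t ht hd _ => hbase t ht hd
  | cons D As ih =>
    intro t ht hd hconv
    rw [List.length_cons] at hd
    have hd' : t.card + 2 + (D :: As).length = d := by rw [List.length_cons]; omega
    have hDt := hconv D (by simp)
    -- The witness is `D`: its square is a product of convex factors.
    refine ⟨degForm_symm h ht _ hd', degForm_add_left _, degForm_smul_left _, D, ?_, ?_⟩
    · exact weightProd_pos h _ t ht (by simp only [List.length_cons]; omega) (by simpa using hconv)
    intro x hx
    obtain ⟨l, hl, hlpos⟩ := hDt t ht subset_rfl
    -- `D` after subtraction of a linear function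
    have hc : ∀ i ∈ linkVertices Δ t, 0 < D i - l (v i) := fun i hi => sub_pos.2 (hlpos i hi)
    have hcard : ∀ i ∈ linkVertices Δ t, (insert i t).card = t.card + 1 := fun i hi =>
      Finset.card_insert_of_notMem (mem_linkVertices.1 hi).1
    have hD : ∀ w : Finset ι → ℝ, IsBalanced Δ v (t.card + 1) w →
        weightAct Δ v D w t = ∑ i ∈ linkVertices Δ t, (D i - l (v i)) * w (insert i t) :=
      fun w hw => weightAct_eq h.toIsFanComplex ht (hw t ht rfl) D l hl
    -- Commuting `D` to the front writes the form at `t` as a positive combination of forms with one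
    -- divisor fewer.
    have hsum : ∀ y z, degForm Δ v W t (D :: As) y z =
        ∑ i ∈ linkVertices Δ t, (D i - l (v i)) * degForm Δ v W (insert i t) As y z := by
      intro y z
      refine Eq.trans ?_ (hD _ (isBalanced_weightProd h (y :: z :: As) (t.card + 1)
        (by simp only [List.length_cons]; omega)))
      rw [← weightProd_cons, weightProd_swap h ht D y (z :: As) (by simp only [List.length_cons]; omega)]
      refine weightAct_congr _ fun i hi => ?_
      exact weightProd_swap h (mem_linkVertices.1 hi).2 z D As (by rw [hcard i hi]; omega)
    -- The same smaller forms give the rows: one argument is used up in moving to `insert i t`, and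
    -- `D` takes its place.
    have hrow : ∀ i ∈ linkVertices Δ t, ∀ y, degForm Δ v W t (D :: As) (Pi.single i 1) y =
        degForm Δ v W (insert i t) As y D := fun i hi y => degForm_single hi _ y
    have hih : ∀ i ∈ linkVertices Δ t, IsHyperbolic (degForm Δ v W (insert i t) As) :=
      fun i hi => ih _ (mem_linkVertices.1 hi).2 (by rw [hcard i hi]; omega) fun a ha =>
        (hconv a (by simp [ha])).mono (Finset.subset_insert _ _)
    have hposi : ∀ i ∈ linkVertices Δ t, 0 < degForm Δ v W (insert i t) As D D := fun i hi =>
      weightProd_pos h _ _ (mem_linkVertices.1 hi).2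
        (by rw [hcard i hi]; simp only [List.length_cons]; omega) (fun a ha => by
          have : a ∈ D :: As := by simpa using ha
          exact (hconv a this).mono (Finset.subset_insert _ _))
    set D' : ι → ℝ := fun i => D i - l (v i) with hD'
    have hD'0 : ∀ j ∈ t, D' j = 0 := fun j hj => by simp [hD', hl j hj]
    have hrowD' : ∀ y, degForm Δ v W t (D :: As) y D' = degForm Δ v W t (D :: As) y D := by
      intro y
      rw [degForm_symm h ht _ hd', degForm_symm h ht _ hd' y]
      exact weightAct_sub_linear h.toIsFanComplex ht (isBalanced_weightProd h (y :: D :: As)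
        (t.card + 1) (by simp only [List.length_cons]; omega) t ht rfl) D l
    -- the matrix of the form
    set n := {i // i ∈ linkVertices Δ t}
    set S : Matrix n n ℝ := fun i j =>
      degForm Δ v W t (D :: As) (Pi.single i.1 1) (Pi.single j.1 1) with hS
    have hsumn : ∀ f : ι → ℝ, ∑ i ∈ linkVertices Δ t, f i = ∑ i : n, f i.1 := fun f =>
      (Finset.sum_coe_sort (linkVertices Δ t) f).symm
    have hSy : ∀ (y : ι → ℝ) (i : n), (S.mulVec fun j : n => residue v t j.1 y) i =
        degForm Δ v W t (D :: As) (Pi.single i.1 1) y := by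
      intro y i
      rw [degForm_symm h ht _ hd', degForm_eq_sum, hsumn]
      refine Finset.sum_congr rfl fun j _ => ?_
      rw [mul_comm, ← degForm_single j.2, degForm_symm h ht _ hd']
    have hSq : ∀ y z : ι → ℝ, (fun j : n => residue v t j.1 y) ⬝ᵥ
        (S.mulVec fun j : n => residue v t j.1 z) = degForm Δ v W t (D :: As) y z := by
      intro y z
      rw [degForm_eq_sum, hsumn]
      refine Finset.sum_congr rfl fun i _ => ?_
      rw [hSy, degForm_single i.2]
    have hext : ∀ y : n → ℝ, ∃ z : ι → ℝ, y = fun j : n => residue v t j.1 z := by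
      intro y
      refine ⟨fun i => if hi : i ∈ linkVertices Δ t then y ⟨i, hi⟩ else 0, funext fun j => ?_⟩
      rw [residue_of_eq_zero]
      · simp
      · intro i hi
        rw [dif_neg fun hi' => (mem_linkVertices.1 hi').1 hi]
    have hcD' : (fun j : n => D' j.1) = fun j : n => residue v t j.1 D' :=
      funext fun j => (residue_of_eq_zero v hD'0 j.1).symm
    have hSc : ∀ i : n, S.mulVec (fun j : n => D' j.1) i = degForm Δ v W (insert i.1 t) As D D := by
      intro i
      rw [hcD', hSy, hrowD', hrow _ i.2]
    rw [← hSq]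
    refine dotProduct_mulVec_nonpos_of_connected S ?_ (fun j : n => D' j.1)
      (fun j => hc j.1 j.2) (fun i => ?_) ?_ ?_ ?_ _ ?_
    · ext i j
      rw [Matrix.conjTranspose_apply, star_trivial]
      exact degForm_symm h ht _ hd' _ _
    · rw [hSc]; exact hposi i.1 i.2
    · intro i j hij
      have hji : j.1 ∉ insert i.1 t := by
        rw [Finset.mem_insert, not_or]
        exact ⟨fun e => hij (Subtype.ext e.symm), (mem_linkVertices.1 j.2).1⟩
      simp only [hS]
      rw [degForm_single_single i.2 hji]
      split_ifs with hj
      · refine (weightProd_pos h _ _ (mem_linkVertices.1 hj).2 ?_ fun a ha => ?_).le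
        · rw [Finset.card_insert_of_notMem hji, hcard i.1 i.2]
          simp only [List.length_cons]; omega
        · exact (hconv a ha).mono ((Finset.subset_insert _ _).trans (Finset.subset_insert _ _))
      · exact le_rfl
    -- The entry of an edge is a product of convex factors, hence positive, so connectedness of the
    -- link supplies enough positive entries.
    · intro p ⟨i, hi⟩ hp j
      have := (hconn t ht (by omega)).2 (fun k => ∃ hk : k ∈ linkVertices Δ t, p ⟨k, hk⟩)
        ⟨i.1, i.2, i.2, hi⟩ (fun k hk m hm ⟨_, hpk⟩ => by
          have hmt := ((linkVertices_swap h.toIsFanComplex k m).1 ⟨hk, hm⟩).2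
          refine ⟨hmt, hp ⟨k, hk⟩ ⟨m, hmt⟩ hpk ?_ ?_⟩
          · intro e
            have : k = m := congrArg Subtype.val e
            exact (mem_linkVertices.1 hm).1 (by simp [this])
          · simp only [hS]
            rw [degForm_single_single hk (mem_linkVertices.1 hm).1, if_pos hm]
            refine weightProd_pos h _ _ (mem_linkVertices.1 hm).2 ?_ fun a ha => ?_
            · rw [Finset.card_insert_of_notMem (mem_linkVertices.1 hm).1, hcard k hk]
              simp only [List.length_cons]; omega
            · exact (hconv a ha).mono
                ((Finset.subset_insert _ _).trans (Finset.subset_insert _ _)))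
        j.1 j.2
      exact this.2
    -- Apply the reversed Cauchy–Schwarz inequality against `D` at each `insert i t`, then sum with
    -- weights `c i`.
    · intro y
      obtain ⟨z, rfl⟩ := hext y
      rw [hSq, hsum, hsumn]
      refine Finset.sum_le_sum fun i _ => ?_
      rw [hSy, hSc, hrow i.1 i.2, mul_div_assoc]
      refine mul_le_mul_of_nonneg_left ?_ (hc i.1 i.2).le
      rw [le_div_iff₀ (hposi i.1 i.2)]
      exact (hih i.1 i.2).mul_le_sq z (hposi i.1 i.2)
    · rw [hcD', hSq, hrowD']; exact hx

/-- If the link of `t` is disconnected, then the degree form at `t` has two positive eigenvalues. -/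
theorem isLinkConnected_of_isHyperbolic (h : IsTropicalComplex Δ v W d) {t : Finset ι} (ht : t ∈ Δ)
    {D : ι → ℝ} (hD : IsConvexAt Δ v t D) {n : ℕ} (hd : t.card + 2 + n = d)
    (hyp : IsHyperbolic (degForm Δ v W t (List.replicate n D))) : IsLinkConnected Δ t := by
  refine ⟨linkVertices_nonempty h ht (by omega), fun p ⟨i₀, hi₀, hpi₀⟩ hp j₀ hj₀ => ?_⟩
  by_contra hpj₀
  set As := List.replicate n D
  have hlen : t.card + 2 + As.length = d := by simpa [As] using hd
  obtain ⟨l, hl, hlpos⟩ := hD t ht subset_rfl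
  set D' : ι → ℝ := fun i => D i - l (v i) with hD'
  have hc : ∀ i ∈ linkVertices Δ t, 0 < D' i := fun i hi => sub_pos.2 (hlpos i hi)
  have hrowD' : ∀ y, degForm Δ v W t As y D' = degForm Δ v W t As y D := by
    intro y
    rw [degForm_symm h ht _ hlen, degForm_symm h ht _ hlen y]
    exact weightAct_sub_linear h.toIsFanComplex ht (isBalanced_weightProd h (y :: As)
      (t.card + 1) (by simp only [List.length_cons]; omega) t ht rfl) D l
  have hrow : ∀ i ∈ linkVertices Δ t, 0 < degForm Δ v W t As (Pi.single i 1) D' := by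
    intro i hi
    rw [hrowD', degForm_single hi]
    refine weightProd_pos h _ _ (mem_linkVertices.1 hi).2 ?_ fun a ha => ?_
    · rw [Finset.card_insert_of_notMem (mem_linkVertices.1 hi).1, List.length_cons]; omega
    · have : a = D := by
        rcases List.mem_cons.1 ha with e | e
        · exact e
        · exact List.eq_of_mem_replicate e
      exact this ▸ hD.mono (Finset.subset_insert _ _)
  -- the parts of `D'` supported on a set of vertices
  set part : (ι → Prop) → ι → ℝ := fun q i => if i ∈ linkVertices Δ t ∧ q i then D' i else 0
    with hpart
  have hpart0 : ∀ q, ∀ j ∈ t, part q j = 0 := fun q j hj =>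
    if_neg fun hj' => (mem_linkVertices.1 hj'.1).1 hj
  have hres : ∀ q i, residue v t i (part q) = part q i := fun q i =>
    residue_of_eq_zero v (hpart0 q) i
  -- No edge joins the two parts, so every matrix entry between them is zero.
  have horth : degForm Δ v W t As (part p) (part fun i => ¬ p i) = 0 := by
    rw [degForm_eq_double_sum h ht As hlen]
    refine Finset.sum_eq_zero fun i hi => ?_
    rw [hres]
    by_cases hpi : p i
    · refine mul_eq_zero_of_right _ (Finset.sum_eq_zero fun j hj => ?_)
      rw [hres]
      by_cases hpj : p j
      · simp [hpart, hpj]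
      · have hji : j ∉ insert i t := by
          rw [Finset.mem_insert, not_or]
          exact ⟨fun e => hpj (e ▸ hpi), (mem_linkVertices.1 hj).1⟩
        rw [degForm_single_single hi hji, if_neg fun hj' => hpj (hp i hi j hj' hpi), zero_mul]
    · simp [hpart, hpi]
  have hsplit : ∀ q, ∀ y, degForm Δ v W t As y D' =
      degForm Δ v W t As y (part q) + degForm Δ v W t As y (part fun i => ¬ q i) := by
    intro q y
    have hD'0 : ∀ j ∈ t, D' j = 0 := fun j hj => by simp [hD', hl j hj]
    rw [degForm_symm h ht _ hlen, degForm_symm h ht _ hlen y, degForm_symm h ht _ hlen y,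
      degForm_eq_sum, degForm_eq_sum, degForm_eq_sum, ← Finset.sum_add_distrib]
    refine Finset.sum_congr rfl fun i hi => ?_
    rw [hres, hres, residue_of_eq_zero v hD'0, ← add_mul]
    congr 1
    by_cases hq : q i <;> simp [hpart, hi, hq]
  have hpos : ∀ q : ι → Prop, (∃ i ∈ linkVertices Δ t, q i) →
      0 < degForm Δ v W t As (part q) D' := by
    rintro q ⟨i, hi, hqi⟩
    rw [degForm_eq_sum]
    have hterm : ∀ i ∈ linkVertices Δ t, residue v t i (part q) *
        weightProd Δ v W (D' :: As) (insert i t) =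
        part q i * degForm Δ v W t As (Pi.single i 1) D' := fun i hi => by
      rw [hres, degForm_single hi]
    rw [Finset.sum_congr rfl hterm]
    refine Finset.sum_pos' (fun j hj => mul_nonneg ?_ (hrow j hj).le) ⟨i, hi, ?_⟩
    · by_cases hqj : q j
      · simpa [hpart, hj, hqj] using (hc j hj).le
      · simp [hpart, hqj]
    · have : part q i = D' i := if_pos ⟨hi, hqi⟩
      rw [this]
      exact mul_pos (hc i hi) (hrow i hi)
  -- Each part pairs positively with `D'`, the sum of both parts, and the cross term vanishes. Two
  -- orthogonal vectors of positive square then violate the reversed Cauchy–Schwarz inequality.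
  have h1 : 0 < degForm Δ v W t As (part p) (part p) := by
    have := hpos p ⟨i₀, hi₀, hpi₀⟩
    rwa [hsplit p, horth, add_zero] at this
  have h2 : 0 < degForm Δ v W t As (part fun i => ¬ p i) (part fun i => ¬ p i) := by
    have := hpos (fun i => ¬ p i) ⟨j₀, hj₀, hpj₀⟩
    rwa [hsplit p, degForm_symm h ht _ hlen _ (part p), horth, zero_add] at this
  have h3 := hyp.mul_le_sq (part p) h2
  rw [horth] at h3
  nlinarith [mul_pos h1 h2]

end Degree

end Complex

/-! ### Cones generated by subfamilies of vectors. -/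

section Cones

variable {ι V : Type*} [AddCommGroup V] [Module ℝ V]

/-- The cone generated by the vectors `v i`, `i ∈ s`. -/
def coneOf (v : ι → V) (s : Finset ι) : PointedCone ℝ V := PointedCone.hull ℝ (v '' s)

theorem apply_mem_coneOf (v : ι → V) {s : Finset ι} {i : ι} (hi : i ∈ s) : v i ∈ coneOf v s :=
  Submodule.subset_span ⟨i, hi, rfl⟩

theorem coneOf_mono (v : ι → V) {s t : Finset ι} (h : s ⊆ t) : coneOf v s ≤ coneOf v t :=
  Submodule.span_mono (Set.image_mono (by exact_mod_cast h))

theorem coneSpan_coneOf (v : ι → V) (s : Finset ι) :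
    coneSpan (coneOf v s) = Submodule.span ℝ (v '' s) := by
  refine le_antisymm (Submodule.span_le.2 (PointedCone.hull_le_span _ _)) (Submodule.span_mono ?_)
  exact Submodule.subset_span

theorem map_coneOf {V' : Type*} [AddCommGroup V'] [Module ℝ V'] (f : V →ₗ[ℝ] V') (v : ι → V)
    (s : Finset ι) : PointedCone.map f (coneOf v s) = coneOf (f ∘ v) s := by
  rw [coneOf, coneOf, Set.image_comp]
  exact Submodule.map_span _ _

end Cones

/-! ### The dictionary between fans and complexes. -/

section FanModel

variable {ι V : Type*} [Fintype ι] [AddCommGroup V] [Module ℝ V]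

theorem mem_coneOf {v : ι → V} {s : Finset ι} {x : V} :
    x ∈ coneOf v s ↔
      ∃ a : ι → ℝ, (∀ i, 0 ≤ a i) ∧ (∀ i ∉ s, a i = 0) ∧ ∑ i, a i • v i = x := by
  constructor
  · intro hx
    refine Submodule.span_induction (p := fun x _ => ∃ a : ι → ℝ, (∀ i, 0 ≤ a i) ∧
      (∀ i ∉ s, a i = 0) ∧ ∑ i, a i • v i = x) ?_ ?_ ?_ ?_ hx
    · rintro _ ⟨i, hi, rfl⟩
      refine ⟨Pi.single i 1, fun j => ?_, fun j hj => ?_, ?_⟩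
      · rw [Pi.single_apply]; split_ifs <;> simp
      · exact Pi.single_eq_of_ne (by rintro rfl; exact hj hi) _
      · simp [Pi.single_apply]
    · exact ⟨0, by simp, by simp, by simp⟩
    · rintro _ _ _ _ ⟨a, ha, has, rfl⟩ ⟨b, hb, hbs, rfl⟩
      exact ⟨a + b, fun i => add_nonneg (ha i) (hb i), fun i hi => by simp [has i hi, hbs i hi],
        by simp [add_smul, Finset.sum_add_distrib]⟩
    · rintro c _ _ ⟨a, ha, has, rfl⟩
      refine ⟨fun i => c * a i, fun i => mul_nonneg c.2 (ha i), fun i hi => by simp [has i hi], ?_⟩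
      rw [Finset.smul_sum]
      refine Finset.sum_congr rfl fun i _ => ?_
      rw [mul_smul]
      rfl
  · rintro ⟨a, ha, has, rfl⟩
    refine Submodule.sum_mem _ fun i _ => ?_
    by_cases hi : i ∈ s
    · exact PointedCone.smul_mem _ (ha i) (Submodule.subset_span ⟨i, hi, rfl⟩)
    · simp [has i hi]

/-- Makes the calculus of faces available for a single simplicial cone, before the whole fan is
known to come from a complex. -/
theorem isFanComplex_powerset {v : ι → V} {s : Finset ι} (h : LinearIndepOn ℝ v (s : Set ι)) :
    IsFanComplex s.powerset v where
  down_closed r hr t ht := Finset.mem_powerset.2 (ht.trans (Finset.mem_powerset.1 hr))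
  inj r hr t ht a b _ _ har hbt hab := by
    have h0 : ∀ f : ι → ℝ, ∀ r ⊆ s, (∀ i ∉ r, f i = 0) → ∑ i, f i • v i = ∑ i ∈ s, f i • v i :=
      fun f r hr hf => (Finset.sum_subset (Finset.subset_univ s) fun i _ hi => by
        simp [hf i fun h => hi (hr h)]).symm
    rw [h0 a r (Finset.mem_powerset.1 hr) har, h0 b t (Finset.mem_powerset.1 ht) hbt,
      ← sub_eq_zero, ← Finset.sum_sub_distrib] at hab
    simp only [← sub_smul] at hab
    funext i
    by_cases hi : i ∈ s
    · exact sub_eq_zero.1 ((linearIndepOn_finset_iff.1 h) _ hab i hi)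
    · rw [har i fun h => hi (Finset.mem_powerset.1 hr h),
        hbt i fun h => hi (Finset.mem_powerset.1 ht h)]

variable {Δ : Finset (Finset ι)} {v : ι → V}

namespace IsFanComplex

theorem coneDim_coneOf (h : IsFanComplex Δ v) {s : Finset ι} (hs : s ∈ Δ) :
    coneDim (coneOf v s) = s.card := by
  have hli := h.linearIndepOn hs
  rw [coneDim, coneSpan_coneOf, Set.image_eq_range]
  have := finrank_span_eq_card hli
  simpa using this

theorem apply_mem_coneOf_iff (h : IsFanComplex Δ v) {s : Finset ι} (hs : s ∈ Δ) {i : ι}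
    (hi : {i} ∈ Δ) : v i ∈ coneOf v s ↔ i ∈ s := by
  refine ⟨fun hx => ?_, apply_mem_coneOf v⟩
  obtain ⟨a, ha, has, hax⟩ := mem_coneOf.1 hx
  have h1 := h.inj s hs {i} hi a (Pi.single i 1) ha
    (fun j => by rw [Pi.single_apply]; split_ifs <;> simp) has
    (fun j hj => Pi.single_eq_of_ne (by simpa using hj) _) (by rw [hax]; simp [Pi.single_apply])
  by_contra his
  have h2 := has i his
  rw [h1] at h2
  simp at h2

theorem singleton_mem (h : IsFanComplex Δ v) {s : Finset ι} (hs : s ∈ Δ) {i : ι} (hi : i ∈ s) :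
    {i} ∈ Δ := h.down_closed s hs _ (by simpa using hi)

theorem coneOf_le_iff (h : IsFanComplex Δ v) {s t : Finset ι} (hs : s ∈ Δ) (ht : t ∈ Δ) :
    coneOf v s ≤ coneOf v t ↔ s ⊆ t := by
  refine ⟨fun hst i hi => ?_, coneOf_mono v⟩
  exact (h.apply_mem_coneOf_iff ht (h.singleton_mem hs hi)).1 (hst (apply_mem_coneOf v hi))

theorem coneOf_injOn (h : IsFanComplex Δ v) : Set.InjOn (coneOf v) (Δ : Set (Finset ι)) :=
  fun _ hs _ ht hst => subset_antisymm ((h.coneOf_le_iff hs ht).1 hst.le)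
    ((h.coneOf_le_iff ht hs).1 hst.ge)

/-- If `r • x + y` lies in the smaller cone, uniqueness of coordinates makes those of `r • x` and
`y` outside `s` nonnegative with sum zero. -/
theorem isFaceOf_iff (h : IsFanComplex Δ v) {s t : Finset ι} (hs : s ∈ Δ) (ht : t ∈ Δ) :
    (coneOf v s).IsFaceOf (coneOf v t) ↔ s ⊆ t := by
  refine ⟨fun hf => (h.coneOf_le_iff hs ht).1 hf.le, fun hst => ⟨coneOf_mono v hst, ?_⟩⟩
  intro x y r hx hy hr hxy
  obtain ⟨a, ha, hat, rfl⟩ := mem_coneOf.1 hx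
  obtain ⟨b, hb, hbt, rfl⟩ := mem_coneOf.1 hy
  obtain ⟨c, hc, hcs, hceq⟩ := mem_coneOf.1 hxy
  have key := h.inj s hs t ht c (fun i => r * a i + b i) hc
    (fun i => add_nonneg (mul_nonneg hr.le (ha i)) (hb i)) hcs
    (fun i hi => by simp [hat i hi, hbt i hi])
    (by rw [hceq, Finset.smul_sum, ← Finset.sum_add_distrib]
        exact Finset.sum_congr rfl fun i _ => by rw [add_smul, mul_smul])
  refine mem_coneOf.2 ⟨a, ha, fun i hi => ?_, rfl⟩
  have h1 := congrFun key i
  rw [hcs i hi] at h1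
  have h2 : r * a i = 0 := by
    have := mul_nonneg hr.le (ha i)
    have := hb i
    linarith
  exact (mul_eq_zero.1 h2).resolve_left hr.ne'

/-- Faces of cones of a fan complex. -/
theorem exists_of_isFaceOf (h : IsFanComplex Δ v) {t : Finset ι} (ht : t ∈ Δ)
    {σ : PointedCone ℝ V} (hσ : σ.IsFaceOf (coneOf v t)) : ∃ s ∈ Δ, s ⊆ t ∧ coneOf v s = σ := by
  -- A face is generated by the vertices it contains: a point of it with positive coefficient at `i`
  -- forces `v i` into it.
  set s := t.filter fun i => v i ∈ σ
  have hst : s ⊆ t := Finset.filter_subset _ _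
  refine ⟨s, h.down_closed t ht _ hst, hst, le_antisymm ?_ fun x hx => ?_⟩
  · refine Submodule.span_le.2 ?_
    rintro _ ⟨i, hi, rfl⟩
    exact (Finset.mem_filter.1 hi).2
  · obtain ⟨a, ha, hat, rfl⟩ := mem_coneOf.1 (hσ.le hx)
    refine mem_coneOf.2 ⟨a, ha, fun i hi => ?_, rfl⟩
    by_cases hit : i ∈ t
    · by_contra hne
      refine hi (Finset.mem_filter.2 ⟨hit, ?_⟩)
      have hpos : 0 < a i := lt_of_le_of_ne (ha i) (Ne.symm hne)
      rw [← Finset.add_sum_erase _ _ (Finset.mem_univ i)] at hx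
      refine hσ.mem_of_smul_add_mem (apply_mem_coneOf v hit) (Submodule.sum_mem _ fun j _ => ?_)
        hpos hx
      by_cases hj : j ∈ t
      · exact PointedCone.smul_mem _ (ha j) (apply_mem_coneOf v hj)
      · simp [hat j hj]
    · exact hat i hit

end IsFanComplex

/-- The fan `F` marked by `u` is the fan of cones generated by the faces of `Δ`. -/
structure IsFanModel (F : Finset (PointedCone ℝ V)) (u : PointedCone ℝ V → V)
    (Δ : Finset (Finset ι)) (v : ι → V) : Prop extends IsFanComplex Δ v where
  image_eq : Δ.image (coneOf v) = F
  marking : ∀ i, {i} ∈ Δ → u (coneOf v {i}) = v i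

namespace IsFanModel

variable {F : Finset (PointedCone ℝ V)} {u : PointedCone ℝ V → V}

theorem mem_iff (h : IsFanModel F u Δ v) {σ : PointedCone ℝ V} :
    σ ∈ F ↔ ∃ s ∈ Δ, coneOf v s = σ := by
  rw [← h.image_eq, Finset.mem_image]

theorem coneOf_mem (h : IsFanModel F u Δ v) {s : Finset ι} (hs : s ∈ Δ) : coneOf v s ∈ F :=
  h.mem_iff.2 ⟨s, hs, rfl⟩

theorem mem_conesOfDim (h : IsFanModel F u Δ v) {k : ℕ} {σ : PointedCone ℝ V} :
    σ ∈ conesOfDim F k ↔ ∃ s ∈ Δ, s.card = k ∧ coneOf v s = σ := by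
  rw [conesOfDim, Finset.mem_filter, h.mem_iff]
  constructor
  · rintro ⟨⟨s, hs, rfl⟩, hk⟩
    exact ⟨s, hs, by rwa [h.coneDim_coneOf hs] at hk, rfl⟩
  · rintro ⟨s, hs, hk, rfl⟩
    exact ⟨⟨s, hs, rfl⟩, by rwa [h.coneDim_coneOf hs]⟩

theorem mem_rays (h : IsFanModel F u Δ v) {σ : PointedCone ℝ V} :
    σ ∈ conesOfDim F 1 ↔ ∃ i, {i} ∈ Δ ∧ coneOf v {i} = σ := by
  rw [h.mem_conesOfDim]
  constructor
  · rintro ⟨s, hs, hk, rfl⟩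
    obtain ⟨i, rfl⟩ := Finset.card_eq_one.1 hk
    exact ⟨i, hs, rfl⟩
  · rintro ⟨i, hi, rfl⟩
    exact ⟨{i}, hi, by simp, rfl⟩

theorem raysOf_coneOf (h : IsFanModel F u Δ v) {s : Finset ι} (hs : s ∈ Δ) :
    raysOf F (coneOf v s) = s.image fun i => coneOf v {i} := by
  ext σ
  rw [raysOf, Finset.mem_filter, h.mem_rays, Finset.mem_image]
  constructor
  · rintro ⟨⟨i, hi, rfl⟩, hf⟩
    exact ⟨i, by simpa using (h.isFaceOf_iff hi hs).1 hf, rfl⟩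
  · rintro ⟨i, hi, rfl⟩
    have his := h.singleton_mem hs hi
    exact ⟨⟨i, his, rfl⟩, (h.isFaceOf_iff his hs).2 (by simpa using hi)⟩

theorem cofaces_coneOf (h : IsFanModel F u Δ v) {s : Finset ι} (hs : s ∈ Δ) :
    cofaces F (coneOf v s) = (linkVertices Δ s).image fun i => coneOf v (insert i s) := by
  ext σ
  rw [cofaces, Finset.mem_filter, h.mem_conesOfDim, Finset.mem_image, h.coneDim_coneOf hs]
  constructor
  · rintro ⟨⟨t, ht, hcard, rfl⟩, hf⟩
    have hst := (h.isFaceOf_iff hs ht).1 hf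
    obtain ⟨i, hi, rfl⟩ := (Finset.exists_eq_insert_iff (s := s) (t := t)).2 ⟨hst, hcard.symm⟩
    exact ⟨i, mem_linkVertices.2 ⟨hi, ht⟩, rfl⟩
  · rintro ⟨i, hi, rfl⟩
    obtain ⟨his, hi⟩ := mem_linkVertices.1 hi
    exact ⟨⟨_, hi, Finset.card_insert_of_notMem his, rfl⟩,
      (h.isFaceOf_iff hs hi).2 (Finset.subset_insert i s)⟩

theorem sum_cofaces (h : IsFanModel F u Δ v) {s : Finset ι} (hs : s ∈ Δ) {A : Type*}
    [AddCommMonoid A] (f : PointedCone ℝ V → A) :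
    ∑ σ ∈ cofaces F (coneOf v s), f σ = ∑ i ∈ linkVertices Δ s, f (coneOf v (insert i s)) := by
  rw [h.cofaces_coneOf hs, Finset.sum_image]
  intro i hi j hj hij
  obtain ⟨his, hi⟩ := mem_linkVertices.1 hi
  obtain ⟨hjs, hj⟩ := mem_linkVertices.1 hj
  have h1 : insert i s = insert j s := h.coneOf_injOn hi hj hij
  have h2 : i ∈ insert j s := h1 ▸ Finset.mem_insert_self i s
  exact (Finset.mem_insert.1 h2).resolve_right his

theorem extraMark_insert (h : IsFanModel F u Δ v) {s : Finset ι} {i : ι}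
    (hi : i ∈ linkVertices Δ s) : extraMark F u (coneOf v (insert i s)) (coneOf v s) = v i := by
  obtain ⟨his, hi⟩ := mem_linkVertices.1 hi
  have hs := h.down_closed _ hi _ (Finset.subset_insert i s)
  have hiΔ := h.singleton_mem hi (Finset.mem_insert_self i s)
  have : raysOf F (coneOf v (insert i s)) \ raysOf F (coneOf v s) = {coneOf v {i}} := by
    rw [h.raysOf_coneOf hi, h.raysOf_coneOf hs]
    ext σ
    simp only [Finset.mem_sdiff, Finset.mem_image, Finset.mem_insert, Finset.mem_singleton]
    constructor
    · rintro ⟨⟨j, rfl | hj, rfl⟩, hn⟩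
      · rfl
      · exact absurd ⟨j, hj, rfl⟩ hn
    · rintro rfl
      refine ⟨⟨i, Or.inl rfl, rfl⟩, ?_⟩
      rintro ⟨j, hj, hij⟩
      have := h.coneOf_injOn (h.singleton_mem hs hj) hiΔ hij
      exact his (Finset.singleton_injective this ▸ hj)
  rw [extraMark, this, Finset.sum_singleton, h.marking i hiΔ]

theorem isMarking (h : IsFanModel F u Δ v) : IsMarking F u := by
  intro ρ hρ
  obtain ⟨i, hi, rfl⟩ := h.mem_rays.1 hρ
  rw [h.marking i hi]
  refine ⟨apply_mem_coneOf v (by simp), ?_⟩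
  exact (h.linearIndepOn hi).ne_zero (by simp)

theorem balanced_iff (h : IsFanModel F u Δ v) {s : Finset ι} (hs : s ∈ Δ)
    {w : PointedCone ℝ V → ℝ} {W : Finset ι → ℝ}
    (hw : ∀ i ∈ linkVertices Δ s, w (coneOf v (insert i s)) = W (insert i s)) :
    ∑ σ ∈ cofaces F (coneOf v s), w σ • extraMark F u σ (coneOf v s) =
      ∑ i ∈ linkVertices Δ s, W (insert i s) • v i := by
  rw [h.sum_cofaces hs]
  exact Finset.sum_congr rfl fun i hi => by rw [h.extraMark_insert hi, hw i hi]

theorem mem_support (h : IsFanModel F u Δ v) {x : V} :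
    x ∈ support F ↔ ∃ s ∈ Δ, x ∈ coneOf v s := by
  simp only [support, Set.mem_iUnion, exists_prop, h.mem_iff, SetLike.mem_coe]
  constructor
  · rintro ⟨_, ⟨s, hs, rfl⟩, hx⟩
    exact ⟨s, hs, hx⟩
  · rintro ⟨s, hs, hx⟩
    exact ⟨_, ⟨s, hs, rfl⟩, hx⟩

theorem mem_nbhd (h : IsFanModel F u Δ v) {t : Finset ι} (ht : t ∈ Δ) {σ : PointedCone ℝ V} :
    σ ∈ nbhd F (coneOf v t) ↔ ∃ s, s ∪ t ∈ Δ ∧ coneOf v s = σ := by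
  rw [nbhd, Finset.mem_filter]
  constructor
  · rintro ⟨-, ρ, hρ, htρ, hσρ⟩
    obtain ⟨r, hr, rfl⟩ := h.mem_iff.1 hρ
    obtain ⟨s, -, hsr, rfl⟩ := h.exists_of_isFaceOf hr hσρ
    exact ⟨s, h.down_closed r hr _ (Finset.union_subset hsr ((h.isFaceOf_iff ht hr).1 htρ)), rfl⟩
  · rintro ⟨s, hs, rfl⟩
    have hs' := h.down_closed _ hs _ Finset.subset_union_left
    exact ⟨h.coneOf_mem hs', _, h.coneOf_mem hs, (h.isFaceOf_iff ht hs).2 Finset.subset_union_right,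
      (h.isFaceOf_iff hs' hs).2 Finset.subset_union_left⟩

end IsFanModel

theorem IsFanComplex.apply_ne_zero (h : IsFanComplex Δ v) {s : Finset ι} (hs : s ∈ Δ) {i : ι}
    (hi : i ∈ s) : v i ≠ 0 := (h.linearIndepOn hs).ne_zero hi

theorem IsFanModel.apply_mem_support (h : IsFanModel F u Δ v) {s : Finset ι} (hs : s ∈ Δ) {i : ι}
    (hi : i ∈ s) : v i ∈ support F \ {0} :=
  ⟨h.mem_support.2 ⟨s, hs, apply_mem_coneOf v hi⟩, h.apply_ne_zero hs hi⟩

/-- The marked tropical fan `(F, u, w)` is the fan of the tropical complex `(Δ, v, W)`. -/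
structure IsTropicalModel (F : Finset (PointedCone ℝ V)) (u : PointedCone ℝ V → V)
    (w : PointedCone ℝ V → ℝ) (d : ℕ) (Δ : Finset (Finset ι)) (v : ι → V)
    (W : Finset ι → ℝ) : Prop extends IsTropicalComplex Δ v W d, IsFanModel F u Δ v where
  weight : ∀ s ∈ Δ, s.card = d → w (coneOf v s) = W s

end FanModel

/-! ### Piecewise linear functions as values at the marks. -/

section PiecewiseLinear

variable {ι V : Type*} [Fintype ι] [AddCommGroup V] [Module ℝ V]
  {Δ : Finset (Finset ι)} {v : ι → V}

/-- The coordinates of a point of the support of a fan complex with respect to the marks. -/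
def coords (Δ : Finset (Finset ι)) (v : ι → V) (x : V) : ι → ℝ :=
  if h : ∃ a : ι → ℝ, ∃ s ∈ Δ, (∀ i, 0 ≤ a i) ∧ (∀ i ∉ s, a i = 0) ∧ ∑ i, a i • v i = x then
    h.choose else 0

theorem IsFanComplex.coords_sum (h : IsFanComplex Δ v) {s : Finset ι} (hs : s ∈ Δ) {a : ι → ℝ}
    (ha : ∀ i, 0 ≤ a i) (has : ∀ i ∉ s, a i = 0) : coords Δ v (∑ i, a i • v i) = a := by
  have hex : ∃ b : ι → ℝ, ∃ t ∈ Δ, (∀ i, 0 ≤ b i) ∧ (∀ i ∉ t, b i = 0) ∧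
      ∑ i, b i • v i = ∑ i, a i • v i := ⟨a, s, hs, ha, has, rfl⟩
  rw [coords, dif_pos hex]
  obtain ⟨t, ht, h0, h1, h2⟩ := hex.choose_spec
  exact h.inj t ht s hs _ a h0 ha h1 has h2

/-- On a cone, the interpolation of the values `a` agrees with a linear function. -/
theorem IsFanComplex.sum_coords_eq (h : IsFanComplex Δ v) {s : Finset ι} (hs : s ∈ Δ) (a : ι → ℝ)
    {l : Module.Dual ℝ V} (hl : ∀ i ∈ s, l (v i) = a i) {x : V} (hx : x ∈ coneOf v s) :
    ∑ i, a i * coords Δ v x i = l x := by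
  obtain ⟨c, hc, hcs, rfl⟩ := mem_coneOf.1 hx
  rw [h.coords_sum hs hc hcs, map_sum]
  refine Finset.sum_congr rfl fun i _ => ?_
  by_cases hi : i ∈ s
  · rw [map_smul, hl i hi, smul_eq_mul, mul_comm]
  · simp [hcs i hi]

variable [TopologicalSpace V] [IsTopologicalAddGroup V] [ContinuousSMul ℝ V] [T2Space V]
  [FiniteDimensional ℝ V]

/-- The half-spaces of the dual basis cut the cone out of its span. -/
theorem IsFanComplex.isClosed_coneOf (h : IsFanComplex Δ v) {s : Finset ι} (hs : s ∈ Δ) :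
    IsClosed (coneOf v s : Set V) := by
  have : (coneOf v s : Set V) = (Submodule.span ℝ (v '' s) : Set V) ∩
      ⋂ i ∈ s, {x | 0 ≤ extension v s (Pi.single i 1) x} := by
    ext x
    simp only [Set.mem_inter_iff, Set.mem_iInter, Set.mem_ofPred_eq, SetLike.mem_coe]
    constructor
    · intro hx
      refine ⟨PointedCone.hull_le_span _ _ hx, fun i hi => ?_⟩
      obtain ⟨c, hc, hcs, rfl⟩ := mem_coneOf.1 hx
      rw [map_sum]
      refine Finset.sum_nonneg fun j _ => ?_
      by_cases hj : j ∈ s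
      · rw [map_smul, h.extension_apply hs _ hj, smul_eq_mul, Pi.single_apply]
        exact mul_nonneg (hc j) (by split_ifs <;> simp)
      · simp [hcs j hj]
    · rintro ⟨hx, hpos⟩
      refine mem_coneOf.2 ⟨fun i => if i ∈ s then extension v s (Pi.single i 1) x else 0,
        fun i => ?_, fun i hi => if_neg hi, ?_⟩
      · dsimp only
        split_ifs with hi
        · exact hpos i hi
        · exact le_rfl
      · simp only [ite_smul, zero_smul, Finset.sum_ite_mem, Finset.univ_inter]
        have hle : Submodule.span ℝ (v '' s) ≤ LinearMap.eqLocus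
            (∑ i ∈ s, (extension v s (Pi.single i 1)).smulRight (v i)) LinearMap.id := by
          rw [Submodule.span_le]
          rintro _ ⟨j, hj, rfl⟩
          simp only [SetLike.mem_coe, LinearMap.mem_eqLocus, LinearMap.sum_apply,
            LinearMap.smulRight_apply, LinearMap.id_apply]
          rw [Finset.sum_congr rfl fun i _ => by rw [h.extension_apply hs _ hj]]
          have hj' : j ∈ s := hj
          simp [Pi.single_apply, hj']
        simpa using hle hx
  rw [this]
  refine (Submodule.closed_of_finiteDimensional _).inter (isClosed_biInter fun i _ => ?_)
  exact isClosed_le continuous_const (LinearMap.continuous_of_finiteDimensional _)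

variable {F : Finset (PointedCone ℝ V)} {u : PointedCone ℝ V → V}

/-- The piecewise linear function with prescribed values at the marks. -/
def plOf (h : IsFanModel F u Δ v) : (ι → ℝ) →ₗ[ℝ] PL F where
  toFun a := ⟨fun x => ∑ i, a i * coords Δ v x i, by
    have hlin : ∀ σ ∈ F, ∃ l : Module.Dual ℝ V, ∀ x : support F, (x : V) ∈ σ →
        ∑ i, a i * coords Δ v x i = l x := by
      intro σ hσ
      obtain ⟨s, hs, rfl⟩ := h.mem_iff.1 hσ
      exact ⟨extension v s a, fun x hx =>
        h.sum_coords_eq hs a (fun i hi => h.extension_apply hs a hi) hx⟩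
    refine ⟨?_, hlin⟩
    -- Continuity is glued from finitely many closed cones, on each of which the function is linear.
    refine (locallyFinite_of_finite fun σ : {σ // σ ∈ F} =>
      {x : support F | (x : V) ∈ σ.1}).continuous ?_ ?_ ?_
    · rw [Set.eq_univ_iff_forall]
      rintro ⟨x, hx⟩
      obtain ⟨σ, hσ, hxσ⟩ := Set.mem_iUnion₂.1 hx
      exact Set.mem_iUnion.2 ⟨⟨σ, hσ⟩, hxσ⟩
    · rintro ⟨σ, hσ⟩
      obtain ⟨s, hs, rfl⟩ := h.mem_iff.1 hσ
      exact (h.isClosed_coneOf hs).preimage continuous_subtype_val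
    · rintro ⟨σ, hσ⟩
      obtain ⟨l, hl⟩ := hlin σ hσ
      refine ContinuousOn.congr (f := fun x : support F => l x) ?_ fun x hx => hl x hx
      exact ((LinearMap.continuous_of_finiteDimensional l).comp
        continuous_subtype_val).continuousOn⟩
  map_add' a b := by
    ext x
    simp [add_mul, Finset.sum_add_distrib]
  map_smul' c a := by
    ext x
    simp [mul_assoc, Finset.mul_sum]

theorem plOf_apply (h : IsFanModel F u Δ v) (a : ι → ℝ) {s : Finset ι} (hs : s ∈ Δ)
    {l : Module.Dual ℝ V} (hl : ∀ i ∈ s, l (v i) = a i) {x : support F}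
    (hx : (x : V) ∈ coneOf v s) : (plOf h a).1 x = l x :=
  h.sum_coords_eq hs a hl hx

theorem plOf_surjective (h : IsFanModel F u Δ v) : Function.Surjective (plOf h) := by
  rintro φ
  -- The default `0` is used only at indices that lie in no face.
  refine ⟨fun i => if hi : v i ∈ support F then φ.1 ⟨v i, hi⟩ else 0, ?_⟩
  ext x
  obtain ⟨s, hs, hx⟩ := h.mem_support.1 x.2
  obtain ⟨l, hl⟩ := φ.2.2 _ (h.coneOf_mem hs)
  rw [hl x hx]
  refine plOf_apply h _ hs (fun i hi => ?_) hx
  have hi' : v i ∈ support F := h.mem_support.2 ⟨s, hs, apply_mem_coneOf v hi⟩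
  rw [dif_pos hi', hl ⟨v i, hi'⟩ (apply_mem_coneOf v hi)]

/-- The divisor of the piecewise linear function with prescribed values at the marks. -/
def divisorOf (h : IsFanModel F u Δ v) : (ι → ℝ) →ₗ[ℝ] Divisor F :=
  (linearFunctions F).mkQ.comp (plOf h)

theorem divisorOf_surjective (h : IsFanModel F u Δ v) : Function.Surjective (divisorOf h) :=
  (linearFunctions F).mkQ_surjective.comp (plOf_surjective h)

/-- `act` uses an arbitrary representative; `act_apply_eq` replaces it by `plOf h a` with one linear
function per cone. The weights are compared only on the cofaces of `s`, which is all that an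
induction over a product provides. -/
theorem act_divisorOf (h : IsFanModel F u Δ v) (a : ι → ℝ) {s : Finset ι} (hs : s ∈ Δ)
    {w : PointedCone ℝ V → ℝ} {W : Finset ι → ℝ}
    (hw : ∀ i ∈ linkVertices Δ s, w (coneOf v (insert i s)) = W (insert i s))
    (hW : ∑ i ∈ linkVertices Δ s, W (insert i s) • v i ∈ Submodule.span ℝ (v '' s)) :
    act u (divisorOf h a) w (coneOf v s) = weightAct Δ v a W s := by
  have hsp := h.balanced_iff hs hw
  have hex : ∀ σ : PointedCone ℝ V, ∃ l : Module.Dual ℝ V, σ ∈ F → ∃ t ∈ Δ, coneOf v t = σ ∧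
      ∀ i ∈ t, l (v i) = a i := fun σ => by
    by_cases hσ : σ ∈ F
    · obtain ⟨t, ht, rfl⟩ := h.mem_iff.1 hσ
      exact ⟨extension v t a, fun _ => ⟨t, ht, rfl, fun i hi => h.extension_apply ht a hi⟩⟩
    · exact ⟨0, fun hσ' => absurd hσ' hσ⟩
  choose l hl using hex
  have hl' : ∀ t ∈ Δ, ∀ i ∈ t, l (coneOf v t) (v i) = a i := fun t ht i hi => by
    obtain ⟨t', ht', heq, hv⟩ := hl _ (h.coneOf_mem ht)
    exact hv i (h.coneOf_injOn ht' ht heq ▸ hi)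
  have key := act_apply_eq h.isMarking (h.coneOf_mem hs) (w := w)
    (by rw [hsp, coneSpan_coneOf]; exact hW) (plOf h a) l (fun σ hσ x hx => by
      obtain ⟨t, ht, rfl⟩ := h.mem_iff.1 hσ
      exact plOf_apply h a ht (hl' t ht) hx)
  refine key.trans ?_
  rw [hsp, h.sum_cofaces hs, map_sum, ← Finset.sum_sub_distrib,
    weightAct_eq h.toIsFanComplex hs hW a (l (coneOf v s)) (hl' s hs)]
  refine Finset.sum_congr rfl fun i hi => ?_
  rw [h.extraMark_insert hi, hw i hi, map_smul, map_smul,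
    hl' _ (mem_linkVertices.1 hi).2 i (Finset.mem_insert_self i s)]
  simp only [smul_eq_mul]
  ring

/-- A value of a piecewise linear function is a combination of its values at the marks with
nonnegative coordinates, so positivity off a cone needs testing only at the marks of link vertices.
-/
theorem isStrictlyConvex_divisorOf (h : IsFanModel F u Δ v) (a : ι → ℝ) :
    IsStrictlyConvex (divisorOf h a) ↔ IsConvexAt Δ v ∅ a := by
  have hmem : ∀ {s : Finset ι}, s ∈ Δ → ∀ {i}, i ∈ s → v i ∈ support F := fun hs i hi =>
    h.mem_support.2 ⟨_, hs, apply_mem_coneOf v hi⟩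
  constructor
  · intro hconv s hs _
    obtain ⟨φ, hφ, hφ0, hφpos⟩ := hconv _ (h.coneOf_mem hs)
    obtain ⟨m, hm⟩ := (Submodule.Quotient.eq (linearFunctions F)).1 hφ
    have hm' : ∀ x : support F, φ.1 x = (plOf h a).1 x + m x := fun x => by
      have := hm x
      simp only [Submodule.coe_sub, Pi.sub_apply] at this
      linarith
    have hval : ∀ {t : Finset ι}, t ∈ Δ → ∀ {i}, (hi : i ∈ t) → ∀ hi',
        φ.1 ⟨v i, hi'⟩ = a i + m (v i) := fun ht i hi hi' => by
      rw [hm', plOf_apply h a ht (l := extension v _ a) (fun i hi => h.extension_apply ht a hi)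
        (apply_mem_coneOf v hi), h.extension_apply ht a hi]
    refine ⟨-m, fun j hj => ?_, fun i hi => ?_⟩
    · have h1 := hφ0 ⟨v j, hmem hs hj⟩ (apply_mem_coneOf v hj)
      rw [hval hs hj] at h1
      rw [LinearMap.neg_apply]
      linarith
    · obtain ⟨his, hi⟩ := mem_linkVertices.1 hi
      have hins := Finset.mem_insert_self i s
      have h1 := hφpos ⟨v i, hmem hi hins⟩ (Set.mem_iUnion₂.2 ⟨coneOf v (insert i s),
        (h.mem_nbhd hs).2 ⟨_, by
          rwa [Finset.union_eq_left.2 (Finset.subset_insert i s)], rfl⟩, apply_mem_coneOf v hins⟩)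
        (fun hx => his ((h.apply_mem_coneOf_iff hs (h.singleton_mem hi hins)).1 hx))
      rw [hval hi hins] at h1
      rw [LinearMap.neg_apply]
      linarith
  · intro hconv τ hτ
    obtain ⟨s, hs, rfl⟩ := h.mem_iff.1 hτ
    obtain ⟨l, hl, hpos⟩ := hconv s hs (Finset.empty_subset s)
    set b : ι → ℝ := fun i => a i - l (v i) with hb
    have hbs : ∀ i ∈ s, b i = 0 := fun i hi => by simp [hb, hl i hi]
    refine ⟨plOf h b, ?_, fun x hx => ?_, fun x hx hxs => ?_⟩
    · refine (Submodule.Quotient.eq (linearFunctions F)).2 ⟨-l, fun x => ?_⟩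
      obtain ⟨t, ht, hxt⟩ := h.mem_support.1 x.2
      have e1 := plOf_apply h a ht (l := extension v t a) (fun i hi => h.extension_apply ht a hi) hxt
      have e2 := plOf_apply h b ht (l := extension v t a - l)
        (fun i hi => by simp [hb, h.extension_apply ht a hi]) hxt
      simp [e1, e2]
    · rw [plOf_apply h b hs (l := 0) (fun i hi => by simp [hbs i hi]) hx]
      rfl
    · obtain ⟨σ, hσ, hxσ⟩ := Set.mem_iUnion₂.1 hx
      obtain ⟨r, hr, rfl⟩ := (h.mem_nbhd hs).1 hσ
      have hr' := h.down_closed _ hr _ Finset.subset_union_left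
      obtain ⟨c, hc, hcr, hcx⟩ := mem_coneOf.1 hxσ
      have hbr : ∀ i ∈ r, 0 ≤ b i ∧ (i ∉ s → 0 < b i) := fun i hi => by
        by_cases his : i ∈ s
        · exact ⟨(hbs i his).ge, fun h => absurd his h⟩
        · have : 0 < b i := sub_pos.2 (hpos i (mem_linkVertices.2 ⟨his, h.down_closed _ hr _
            (Finset.insert_subset (Finset.mem_union_left s hi) Finset.subset_union_right)⟩))
          exact ⟨this.le, fun _ => this⟩
      have hval : (plOf h b).1 x = ∑ i, b i * c i := by
        change ∑ i, b i * coords Δ v x i = _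
        rw [← hcx, h.coords_sum hr' hc hcr]
      obtain ⟨i, his, hci⟩ : ∃ i ∉ s, c i ≠ 0 := by
        by_contra! hcon
        exact hxs (mem_coneOf.2 ⟨c, hc, hcon, hcx⟩)
      have hir : i ∈ r := by
        by_contra hir
        exact hci (hcr i hir)
      rw [hval]
      refine Finset.sum_pos' (fun j _ => ?_) ⟨i, Finset.mem_univ _,
        mul_pos ((hbr i hir).2 his) (lt_of_le_of_ne (hc i) (Ne.symm hci))⟩
      by_cases hj : j ∈ r
      · exact mul_nonneg (hbr j hj).1 (hc j)
      · simp [hcr j hj]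

variable {w : PointedCone ℝ V → ℝ} {d : ℕ} {W : Finset ι → ℝ}

theorem foldr_act_divisorOf (h : IsTropicalModel F u w d Δ v W) (As : List (ι → ℝ)) :
    ∀ s ∈ Δ, s.card + As.length = d →
      (As.map (divisorOf h.toIsFanModel)).foldr (act u) w (coneOf v s) =
        weightProd Δ v W As s := by
  induction As with
  | nil => exact fun s hs hd => h.weight s hs hd
  | cons a As ih =>
    intro s hs hd
    rw [List.length_cons] at hd
    rw [List.map_cons, List.foldr_cons, weightProd_cons]
    refine act_divisorOf h.toIsFanModel a hs (fun i hi => ?_)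
      (isBalanced_weightProd h.toIsTropicalComplex As _ (by omega) s hs rfl)
    obtain ⟨his, hi⟩ := mem_linkVertices.1 hi
    exact ih _ hi (by rw [Finset.card_insert_of_notMem his]; omega)

theorem deg_divisorOf (h : IsTropicalModel F u w d Δ v W) (h0 : ∅ ∈ Δ) (As : List (ι → ℝ))
    (hd : As.length = d) :
    deg u w (As.map (divisorOf h.toIsFanModel)) = weightProd Δ v W As ∅ := by
  rw [← foldr_act_divisorOf h As ∅ h0 (by simpa using hd), deg]
  simp [coneOf]

end PiecewiseLinear

/-! ### The complex of rays of a simplicial fan. -/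

section Rays

variable {V : Type*} [AddCommGroup V] [Module ℝ V] {F : Finset (PointedCone ℝ V)}
  {u : PointedCone ℝ V → V}

/-- The rays of `F` that are faces of `σ`, as a set of rays of `F`. -/
def raySet (F : Finset (PointedCone ℝ V)) (σ : PointedCone ℝ V) :
    Finset {ρ // ρ ∈ conesOfDim F 1} :=
  Finset.univ.filter fun ρ => ρ.1.IsFaceOf σ

/-- The simplicial complex of a simplicial fan, on the set of rays. -/
def rayComplex (F : Finset (PointedCone ℝ V)) : Finset (Finset {ρ // ρ ∈ conesOfDim F 1}) :=
  F.image (raySet F)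

/-- The marks of the rays of `F`. -/
def rayMark (F : Finset (PointedCone ℝ V)) (u : PointedCone ℝ V → V)
    (ρ : {ρ // ρ ∈ conesOfDim F 1}) : V := u ρ

theorem mem_raySet {σ : PointedCone ℝ V} {ρ : {ρ // ρ ∈ conesOfDim F 1}} :
    ρ ∈ raySet F σ ↔ ρ.1.IsFaceOf σ := by simp [raySet]

theorem mem_rayComplex {s : Finset {ρ // ρ ∈ conesOfDim F 1}} :
    s ∈ rayComplex F ↔ ∃ σ ∈ F, raySet F σ = s := Finset.mem_image

/-- The generators provided by simpliciality need not be the marks, but each one spans a ray of `F`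
whose mark is a positive multiple of it; independence and generation carry over. -/
theorem raySet_spec (hF : IsSimplicialFan F) (hu : IsMarking F u) {σ : PointedCone ℝ V}
    (hσ : σ ∈ F) :
    LinearIndepOn ℝ (rayMark F u) (raySet F σ : Set _) ∧
      coneOf (rayMark F u) (raySet F σ) = σ := by
  obtain ⟨S, hS, hli, hSσ⟩ := hF.simplicial σ hσ
  have : Fintype S := hS.fintype
  have hli' : LinearIndepOn ℝ (Subtype.val : S → V) ((Finset.univ : Finset S) : Set S) := by
    have h1 : LinearIndependent ℝ (Subtype.val : S → V) := hli
    exact h1.linearIndepOn _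
  have hcx := isFanComplex_powerset hli'
  have hmem : ∀ s : Finset S, s ∈ (Finset.univ : Finset S).powerset := fun s => by simp
  have hσ' : coneOf (Subtype.val : S → V) Finset.univ = σ := by
    rw [← hSσ, coneOf]; simp
  have hface : ∀ s : Finset S, (coneOf (Subtype.val : S → V) s).IsFaceOf σ := fun s => by
    rw [← hσ']; exact (hcx.isFaceOf_iff (hmem _) (hmem _)).2 (Finset.subset_univ s)
  have hrayF : ∀ x : S, coneOf (Subtype.val : S → V) {x} ∈ conesOfDim F 1 := fun x =>
    Finset.mem_filter.2 ⟨hF.face_mem σ hσ _ (hface _), by simp [hcx.coneDim_coneOf (hmem {x})]⟩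
  have hray : ∀ ρ : {ρ // ρ ∈ raySet F σ}, ∃ x : S,
      coneOf (Subtype.val : S → V) {x} = ρ.1.1 := by
    rintro ⟨ρ, hρ⟩
    have hρσ := mem_raySet.1 hρ
    rw [← hσ'] at hρσ
    obtain ⟨r, -, -, hr⟩ := hcx.exists_of_isFaceOf (hmem _) hρσ
    have hdim := (Finset.mem_filter.1 ρ.2).2
    rw [← hr, hcx.coneDim_coneOf (hmem r)] at hdim
    obtain ⟨x, rfl⟩ := Finset.card_eq_one.1 hdim
    exact ⟨x, hr⟩
  have hmark : ∀ (ρ : {ρ // ρ ∈ conesOfDim F 1}) (x : S),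
      coneOf (Subtype.val : S → V) {x} = ρ.1 → ∃ c : ℝ, 0 < c ∧ rayMark F u ρ = c • x.1 := by
    intro ρ x hx
    obtain ⟨h1, h2⟩ := hu ρ.1 ρ.2
    rw [← hx] at h1
    obtain ⟨a, ha, ha0, hax⟩ := mem_coneOf.1 h1
    have h3 : u ρ.1 = a x • x.1 := by
      rw [← hx, ← hax, Finset.sum_eq_single x]
      · exact fun y _ hy => by simp [ha0 y (by simpa using hy)]
      · simp
    refine ⟨a x, lt_of_le_of_ne (ha x) fun h0 => h2 ?_, h3⟩
    rw [h3, ← h0, zero_smul]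
  constructor
  · choose x hx using hray
    choose c hc hcx' using fun ρ : {ρ // ρ ∈ raySet F σ} => hmark ρ.1 (x ρ) (hx ρ)
    have hxinj : Function.Injective x := fun ρ ρ' h => by
      apply Subtype.ext; apply Subtype.ext
      rw [← hx, ← hx, h]
    have h1 : LinearIndependent ℝ (fun ρ => (x ρ).1) := LinearIndependent.comp hli x hxinj
    have h2 := h1.units_smul fun ρ => Units.mk0 (c ρ) (hc ρ).ne'
    change LinearIndependent ℝ fun ρ : {ρ // ρ ∈ raySet F σ} => rayMark F u ρ.1
    convert h2 using 1
    funext ρ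
    exact hcx' ρ
  · refine le_antisymm (Submodule.span_le.2 ?_) ?_
    · rintro _ ⟨ρ, hρ, rfl⟩
      exact (mem_raySet.1 hρ).le (hu ρ.1 ρ.2).1
    · rw [← hσ']
      refine Submodule.span_le.2 ?_
      rintro _ ⟨x, -, rfl⟩
      obtain ⟨c, hc, hcx'⟩ := hmark ⟨_, hrayF x⟩ x rfl
      have : x.1 = c⁻¹ • rayMark F u ⟨_, hrayF x⟩ := by
        rw [hcx', smul_smul, inv_mul_cancel₀ hc.ne', one_smul]
      rw [this, SetLike.mem_coe, hσ']
      exact PointedCone.smul_mem _ (inv_nonneg.2 hc.le)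
        (apply_mem_coneOf _ (mem_raySet.2 (hface {x})))

theorem raySet_ray (hF : IsSimplicialFan F) (hu : IsMarking F u)
    (ρ : {ρ // ρ ∈ conesOfDim F 1}) : raySet F ρ.1 = {ρ} := by
  obtain ⟨hρ, hdim⟩ := Finset.mem_filter.1 ρ.2
  obtain ⟨h1, h2⟩ := raySet_spec hF hu hρ
  rw [← h2, (isFanComplex_powerset h1).coneDim_coneOf (Finset.mem_powerset_self _)] at hdim
  obtain ⟨η, hη⟩ := Finset.card_eq_one.1 hdim
  have : ρ ∈ raySet F ρ.1 := mem_raySet.2 (PointedCone.IsFaceOf.refl _)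
  rw [hη, Finset.mem_singleton] at this
  rw [hη, this]

theorem coneOf_singleton_ray (hF : IsSimplicialFan F) (hu : IsMarking F u)
    (ρ : {ρ // ρ ∈ conesOfDim F 1}) : coneOf (rayMark F u) {ρ} = ρ.1 := by
  rw [← raySet_ray hF hu ρ]
  exact (raySet_spec hF hu (Finset.mem_filter.1 ρ.2).1).2

/-- Every marked simplicial fan comes from a fan complex. -/
theorem isFanModel_rayComplex (hF : IsSimplicialFan F) (hu : IsMarking F u) :
    IsFanModel F u (rayComplex F) (rayMark F u) where
  down_closed s hs t hts := by
    obtain ⟨σ, hσ, rfl⟩ := mem_rayComplex.1 hs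
    obtain ⟨h1, h2⟩ := raySet_spec hF hu hσ
    have hcx := isFanComplex_powerset h1
    have htF := (hcx.isFaceOf_iff (Finset.mem_powerset.2 hts) (Finset.mem_powerset_self _)).2 hts
    rw [h2] at htF
    refine mem_rayComplex.2 ⟨_, hF.face_mem σ hσ _ htF, ?_⟩
    ext ρ
    rw [mem_raySet]
    constructor
    · intro hρ
      have hρσ : {ρ} ⊆ raySet F σ :=
        Finset.singleton_subset_iff.2 (mem_raySet.2 (hρ.trans htF))
      rw [← coneOf_singleton_ray hF hu ρ, hcx.isFaceOf_iff (Finset.mem_powerset.2 hρσ)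
        (Finset.mem_powerset.2 hts)] at hρ
      simpa using hρ
    · intro hρ
      have hρt : {ρ} ⊆ t := by simpa using hρ
      rw [← coneOf_singleton_ray hF hu ρ]
      exact (hcx.isFaceOf_iff (Finset.mem_powerset.2 (hρt.trans hts))
        (Finset.mem_powerset.2 hts)).2 hρt
  inj s hs t ht a b ha hb has hbt hab := by
    obtain ⟨σ, hσ, rfl⟩ := mem_rayComplex.1 hs
    obtain ⟨τ, hτ, rfl⟩ := mem_rayComplex.1 ht
    obtain ⟨-, hσ2⟩ := raySet_spec hF hu hσ
    obtain ⟨hτ1, hτ2⟩ := raySet_spec hF hu hτ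
    have hxσ : ∑ i, a i • rayMark F u i ∈ σ := by
      rw [← hσ2]; exact mem_coneOf.2 ⟨a, ha, has, rfl⟩
    have hxτ : ∑ i, a i • rayMark F u i ∈ τ := by
      rw [← hτ2]; exact mem_coneOf.2 ⟨b, hb, hbt, hab.symm⟩
    have hl := hF.inter_isFaceOf_left σ hσ τ hτ
    have hr := hF.inter_isFaceOf_right σ hσ τ hτ
    -- The common point lies in `σ ⊓ τ`, a face of `σ`, so every ray with positive coefficient lies
    -- there and is a ray of `τ`. What remains is uniqueness of coordinates in `τ` alone.
    have haτ : ∀ i ∉ raySet F τ, a i = 0 := by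
      intro i hi
      by_contra hne
      have hpos : 0 < a i := lt_of_le_of_ne (ha i) (Ne.symm hne)
      have hiσ : i ∈ raySet F σ := by
        by_contra h; exact hne (has i h)
      have hmem : ∀ j ∈ raySet F σ, rayMark F u j ∈ σ := fun j hj => by
        have := apply_mem_coneOf (rayMark F u) hj
        rwa [hσ2] at this
      have hui : rayMark F u i ∈ σ ⊓ τ := by
        have hx : ∑ i, a i • rayMark F u i ∈ σ ⊓ τ := ⟨hxσ, hxτ⟩
        rw [← Finset.add_sum_erase _ _ (Finset.mem_univ i)] at hx
        refine hl.mem_of_smul_add_mem (hmem i hiσ) (Submodule.sum_mem _ fun j _ => ?_) hpos hx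
        by_cases hj : j ∈ raySet F σ
        · exact PointedCone.smul_mem _ (ha j) (hmem j hj)
        · simp [has j hj]
      have hle : i.1 ≤ σ ⊓ τ := by
        rw [← coneOf_singleton_ray hF hu i]
        refine Submodule.span_le.2 ?_
        rintro _ ⟨j, hj, rfl⟩
        have : j = i := by simpa using hj
        exact this ▸ hui
      exact hi (mem_raySet.2 ((((mem_raySet.1 hiσ).isFaceOf_iff_le hl).2 hle).trans hr))
    exact (isFanComplex_powerset hτ1).inj _ (Finset.mem_powerset_self _) _
      (Finset.mem_powerset_self _) a b ha hb haτ hbt hab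
  image_eq := by
    rw [rayComplex, Finset.image_image]
    ext σ
    rw [Finset.mem_image]
    constructor
    · rintro ⟨τ, hτ, rfl⟩
      rwa [Function.comp_apply, (raySet_spec hF hu hτ).2]
    · exact fun hσ => ⟨σ, hσ, (raySet_spec hF hu hσ).2⟩
  marking ρ _ := by rw [coneOf_singleton_ray hF hu]; rfl

end Rays

/-! ### From tropical fans to tropical complexes. -/

section Tropical

variable {ι V : Type*} [Fintype ι] [AddCommGroup V] [Module ℝ V]
  {Δ : Finset (Finset ι)} {v : ι → V} {F : Finset (PointedCone ℝ V)} {u : PointedCone ℝ V → V}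
  {w : PointedCone ℝ V → ℝ} {d : ℕ}

theorem IsTropicalFan.isTropicalModel (h : IsTropicalFan F u w d) (hm : IsFanModel F u Δ v) :
    IsTropicalModel F u w d Δ v fun s => w (coneOf v s) := by
  have hfacet : ∀ s ∈ Δ, ∃ t ∈ Δ, s ⊆ t ∧ t.card = d := by
    intro s hs
    obtain ⟨τ, hle, hτ⟩ := F.exists_le_maximal (hm.coneOf_mem hs)
    obtain ⟨t, ht, rfl⟩ := hm.mem_iff.1 hτ.prop
    refine ⟨t, ht, (hm.coneOf_le_iff hs ht).1 hle, ?_⟩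
    rw [← hm.coneDim_coneOf ht]
    exact h.isPureOfDim _ hτ
  refine { hm with exists_facet := hfacet, card_le := ?_, balanced := ?_, pos := ?_, weight := ?_ }
  · intro s hs
    obtain ⟨t, -, hst, hcard⟩ := hfacet s hs
    exact hcard ▸ Finset.card_le_card hst
  · intro s hs hcard
    rw [← hm.balanced_iff hs (w := w) (W := fun s => w (coneOf v s)) fun _ _ => rfl,
      ← coneSpan_coneOf]
    exact h.isMinkowskiWeight _ (hm.coneOf_mem hs) (by rwa [hm.coneDim_coneOf hs])
  · exact fun s hs hcard => h.pos _ (hm.mem_conesOfDim.2 ⟨s, hs, hcard, rfl⟩)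
  · exact fun _ _ _ => rfl

end Tropical

/-! ### Vectors and functions modulo a face. -/

section LinkVector

variable {ι V : Type*} [AddCommGroup V] [Module ℝ V] {t : Finset ι}

/-- The classes of the vectors `v i` modulo the span of the cone of `t`. -/
def linkVector (v : ι → V) (t : Finset ι) : ι → V ⧸ coneSpan (coneOf v t) :=
  (coneSpan (coneOf v t)).mkQ ∘ v

theorem linkVector_eq_zero (v : ι → V) {i : ι} (hi : i ∈ t) : linkVector v t i = 0 := by
  rw [linkVector, Function.comp_apply, Submodule.mkQ_apply, Submodule.Quotient.mk_eq_zero,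
    coneSpan_coneOf]
  exact Submodule.subset_span ⟨i, hi, rfl⟩

/-- Subtraction of the linear function that agrees with `a` on `t`. -/
def normalize (v : ι → V) (t : Finset ι) : (ι → ℝ) →ₗ[ℝ] (ι → ℝ) :=
  LinearMap.pi fun i => residue v t i

theorem normalize_of_eq_zero (v : ι → V) {a : ι → ℝ} (ha : ∀ i ∈ t, a i = 0) :
    normalize v t a = a :=
  funext fun i => residue_of_eq_zero v ha i

theorem coneOf_linkVector_sdiff (v : ι → V) (s : Finset ι) :
    coneOf (linkVector v t) s = coneOf (linkVector v t) (s \ t) := by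
  refine le_antisymm (Submodule.span_le.2 ?_) (coneOf_mono _ Finset.sdiff_subset)
  rintro _ ⟨i, hi, rfl⟩
  by_cases hit : i ∈ t
  · rw [linkVector_eq_zero v hit]
    exact Submodule.zero_mem _
  · exact apply_mem_coneOf _ (Finset.mem_sdiff.2 ⟨hi, hit⟩)

end LinkVector

/-! ### Links as models of stars. -/

section Link

variable {ι V : Type*} [Fintype ι] [AddCommGroup V] [Module ℝ V]
  {Δ : Finset (Finset ι)} {v : ι → V} {W : Finset ι → ℝ} {d : ℕ} {t : Finset ι}

/-- The link of `t` in `Δ`. -/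
def linkComplex (Δ : Finset (Finset ι)) (t : Finset ι) : Finset (Finset ι) :=
  Δ.filter fun s => Disjoint s t ∧ s ∪ t ∈ Δ

theorem IsFanComplex.mem_linkComplex (h : IsFanComplex Δ v) {s : Finset ι} :
    s ∈ linkComplex Δ t ↔ Disjoint s t ∧ s ∪ t ∈ Δ := by
  rw [linkComplex, Finset.mem_filter, and_iff_right_iff_imp]
  exact fun hs => h.down_closed _ hs.2 _ Finset.subset_union_left

theorem IsFanComplex.sdiff_mem_linkComplex (h : IsFanComplex Δ v) {s : Finset ι}
    (hs : s ∪ t ∈ Δ) : s \ t ∈ linkComplex Δ t :=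
  h.mem_linkComplex.2 ⟨Finset.sdiff_disjoint, by rwa [Finset.sdiff_union_self_eq_union]⟩

theorem IsFanComplex.linkVertices_linkComplex (h : IsFanComplex Δ v) {s : Finset ι}
    (hs : s ∈ linkComplex Δ t) :
    linkVertices (linkComplex Δ t) s = linkVertices Δ (s ∪ t) := by
  have hdisj := (h.mem_linkComplex.1 hs).1
  ext i
  rw [mem_linkVertices, mem_linkVertices, h.mem_linkComplex, Finset.disjoint_insert_left,
    Finset.insert_union, Finset.mem_union, not_or]
  tauto

/-- Equality modulo the span of `t` is equality in `V` up to a combination of `t` with coefficients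
`c` of any sign. Putting `c⁻` on one side and `c⁺` on the other gives nonnegative combinations on `s
∪ t` and `r ∪ t`, to which `inj` applies. -/
theorem IsFanComplex.link (h : IsFanComplex Δ v) :
    IsFanComplex (linkComplex Δ t) (linkVector v t) where
  down_closed s hs r hrs := by
    rw [h.mem_linkComplex] at hs ⊢
    exact ⟨hs.1.mono_left hrs, h.down_closed _ hs.2 _ (Finset.union_subset_union_left hrs)⟩
  inj s hs r hr a b ha hb has hbr hab := by
    rw [h.mem_linkComplex] at hs hr
    have hmem : ∑ i, a i • v i - ∑ i, b i • v i ∈ Submodule.span ℝ (v '' t) := by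
      rw [← coneSpan_coneOf, ← Submodule.Quotient.mk_eq_zero, ← Submodule.mkQ_apply, map_sub,
        map_sum, map_sum, sub_eq_zero]
      simpa [linkVector] using hab
    obtain ⟨c, hc⟩ : ∃ c : ι → ℝ, (∀ i ∉ t, c i = 0) ∧
        ∑ i, c i • v i = ∑ i, a i • v i - ∑ i, b i • v i := by
      refine Submodule.span_induction (p := fun x _ => ∃ c : ι → ℝ, (∀ i ∉ t, c i = 0) ∧
        ∑ i, c i • v i = x) ?_ ?_ ?_ ?_ hmem
      · rintro _ ⟨i, hi, rfl⟩
        exact ⟨Pi.single i 1, fun j hj => Pi.single_eq_of_ne (by rintro rfl; exact hj hi) _,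
          by simp [Pi.single_apply]⟩
      · exact ⟨0, by simp, by simp⟩
      · rintro _ _ _ _ ⟨c, hc, rfl⟩ ⟨e, he, rfl⟩
        exact ⟨c + e, fun i hi => by simp [hc i hi, he i hi],
          by simp [add_smul, Finset.sum_add_distrib]⟩
      · rintro r _ _ ⟨c, hc, rfl⟩
        exact ⟨r • c, fun i hi => by simp [hc i hi], by simp [Finset.smul_sum, mul_smul]⟩
    have key := h.inj _ hs.2 _ hr.2 (fun i => a i + (c i)⁻) (fun i => b i + (c i)⁺)
      (fun i => add_nonneg (ha i) (negPart_nonneg _))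
      (fun i => add_nonneg (hb i) (posPart_nonneg _))
      (fun i hi => by
        rw [Finset.mem_union, not_or] at hi
        simp [has i hi.1, hc.1 i hi.2])
      (fun i hi => by
        rw [Finset.mem_union, not_or] at hi
        simp [hbr i hi.1, hc.1 i hi.2])
      (by
        have h1 : ∀ i, c i = (c i)⁺ - (c i)⁻ := fun i => (posPart_sub_negPart (c i)).symm
        have h2 := hc.2
        rw [Finset.sum_congr rfl fun i _ => by rw [h1 i, sub_smul], Finset.sum_sub_distrib] at h2
        simp only [add_smul, Finset.sum_add_distrib]
        rw [sub_eq_sub_iff_add_eq_add] at h2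
        rw [← h2, add_comm])
    funext i
    by_cases hi : i ∈ t
    · rw [has i fun h => (Finset.disjoint_left.1 hs.1) h hi,
        hbr i fun h => (Finset.disjoint_left.1 hr.1) h hi]
    · simpa [hc.1 i hi] using congrFun key i

theorem IsTropicalComplex.link (h : IsTropicalComplex Δ v W d) {n : ℕ} (hn : t.card + n = d) :
    IsTropicalComplex (linkComplex Δ t) (linkVector v t) (fun s => W (s ∪ t)) n where
  toIsFanComplex := h.toIsFanComplex.link
  exists_facet s hs := by
    obtain ⟨hdisj, hst⟩ := h.mem_linkComplex.1 hs
    obtain ⟨r, hr, hsr, hcard⟩ := h.exists_facet _ hst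
    have htr := Finset.subset_union_right.trans hsr
    refine ⟨r \ t, h.sdiff_mem_linkComplex (by rwa [Finset.union_eq_left.2 htr]), ?_, ?_⟩
    · exact Finset.subset_sdiff.2 ⟨Finset.subset_union_left.trans hsr, hdisj⟩
    · rw [Finset.card_sdiff_of_subset htr]; omega
  card_le s hs := by
    obtain ⟨hdisj, hst⟩ := h.mem_linkComplex.1 hs
    have := h.card_le _ hst
    rw [Finset.card_union_of_disjoint hdisj] at this
    omega
  balanced s hs hcard := by
    obtain ⟨hdisj, hst⟩ := h.mem_linkComplex.1 hs
    rw [h.linkVertices_linkComplex hs]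
    have hb := h.balanced _ hst (by rw [Finset.card_union_of_disjoint hdisj]; omega)
    have hb' := Submodule.mem_map_of_mem (f := (coneSpan (coneOf v t)).mkQ) hb
    rw [map_sum] at hb'
    have hle : Submodule.map (coneSpan (coneOf v t)).mkQ
        (Submodule.span ℝ (v '' ((s ∪ t : Finset ι) : Set ι))) ≤
        Submodule.span ℝ (linkVector v t '' s) := by
      rw [Submodule.map_span, Submodule.span_le]
      rintro _ ⟨_, ⟨i, hi, rfl⟩, rfl⟩
      change linkVector v t i ∈ Submodule.span ℝ (linkVector v t '' s)
      rcases Finset.mem_union.1 hi with hi | hi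
      · exact Submodule.subset_span ⟨i, hi, rfl⟩
      · rw [linkVector_eq_zero v hi]
        exact Submodule.zero_mem _
    have := hle hb'
    simp only [map_smul] at this
    simp only [Finset.insert_union]
    exact this
  pos s hs hcard := by
    obtain ⟨hdisj, hst⟩ := h.mem_linkComplex.1 hs
    exact h.pos _ hst (by rw [Finset.card_union_of_disjoint hdisj]; omega)

/-- Linear functions on the quotient pull back to functions that vanish on `t`. As the factors
vanish there too, `weightAct_eq` accepts these pullbacks. -/
theorem weightProd_linkComplex (h : IsTropicalComplex Δ v W d) (As : List (ι → ℝ))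
    (hAs : ∀ a ∈ As, ∀ i ∈ t, a i = 0) :
    ∀ s ∈ linkComplex Δ t, s.card + t.card + As.length = d →
      weightProd (linkComplex Δ t) (linkVector v t) (fun s => W (s ∪ t)) As s =
        weightProd Δ v W As (s ∪ t) := by
  induction As with
  | nil => exact fun _ _ _ => rfl
  | cons a As ih =>
    intro s hs hd
    rw [List.length_cons] at hd
    obtain ⟨hdisj, hst⟩ := h.mem_linkComplex.1 hs
    have hcard := Finset.card_union_of_disjoint hdisj
    have ha := hAs a (by simp)
    rw [weightProd_cons, weightProd_cons, weightAct_eq h.toIsFanComplex hst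
      (isBalanced_weightProd h As _ (by omega) _ hst rfl) a
      ((extension (linkVector v t) s a).comp (coneSpan (coneOf v t)).mkQ)]
    · rw [weightAct, h.linkVertices_linkComplex hs]
      refine Finset.sum_congr rfl fun i hi => ?_
      rw [← h.linkVertices_linkComplex hs] at hi
      obtain ⟨his, hi⟩ := mem_linkVertices.1 hi
      rw [ih (fun b hb => hAs b (by simp [hb])) _ hi (by
        rw [Finset.card_insert_of_notMem his]; omega), Finset.insert_union]
      rfl
    · intro j hj
      change extension (linkVector v t) s a (linkVector v t j) = a j
      rcases Finset.mem_union.1 hj with hj | hj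
      · exact h.toIsFanComplex.link.extension_apply hs a hj
      · rw [linkVector_eq_zero v hj, map_zero, ha j hj]

theorem isConvexAt_linkComplex (h : IsFanComplex Δ v) {a : ι → ℝ} (ha : ∀ i ∈ t, a i = 0) :
    IsConvexAt (linkComplex Δ t) (linkVector v t) ∅ a ↔ IsConvexAt Δ v t a := by
  constructor
  · intro hc r hr htr
    have hs := h.sdiff_mem_linkComplex (t := t) (s := r) (by rwa [Finset.union_eq_left.2 htr])
    obtain ⟨l, hl, hpos⟩ := hc _ hs (Finset.empty_subset _)
    rw [h.linkVertices_linkComplex hs, Finset.sdiff_union_of_subset htr] at hpos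
    refine ⟨l.comp (coneSpan (coneOf v t)).mkQ, fun j hj => ?_, hpos⟩
    change l (linkVector v t j) = a j
    by_cases hjt : j ∈ t
    · rw [linkVector_eq_zero v hjt, map_zero, ha j hjt]
    · exact hl j (Finset.mem_sdiff.2 ⟨hj, hjt⟩)
  · intro hc s hs _
    obtain ⟨l, hl, hpos⟩ := hc _ (h.mem_linkComplex.1 hs).2 Finset.subset_union_right
    refine ⟨(coneSpan (coneOf v t)).liftQ l ?_, fun j hj => ?_, fun i hi => ?_⟩
    · rw [coneSpan_coneOf, Submodule.span_le]
      rintro _ ⟨j, hj, rfl⟩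
      change l (v j) = 0
      rw [hl j (Finset.mem_union_right s hj), ha j hj]
    · exact hl j (Finset.mem_union_left t hj)
    · rw [h.linkVertices_linkComplex hs] at hi
      exact hpos i hi

theorem IsFanComplex.normalize_eq_zero (h : IsFanComplex Δ v) (ht : t ∈ Δ) (a : ι → ℝ) {i : ι}
    (hi : i ∈ t) : normalize v t a i = 0 := by
  simp [normalize, residue_apply, h.extension_apply ht a hi]

/-- Supplies the vanishing on `t` that the passage to the link requires, without changing the
degree. -/
theorem weightProd_normalize (h : IsTropicalComplex Δ v W d) (As : List (ι → ℝ)) :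
    ∀ s ∈ Δ, s.card + As.length = d →
      weightProd Δ v W (As.map (normalize v t)) s = weightProd Δ v W As s := by
  induction As with
  | nil => exact fun _ _ _ => rfl
  | cons a As ih =>
    intro s hs hd
    rw [List.length_cons] at hd
    rw [List.map_cons, weightProd_cons, weightProd_cons, ← weightAct_sub_linear h.toIsFanComplex hs
      (isBalanced_weightProd h As _ (by omega) s hs rfl) a (extension v t a)]
    refine weightAct_congr _ fun i hi => ?_
    obtain ⟨his, hi⟩ := mem_linkVertices.1 hi
    exact ih _ hi (by rw [Finset.card_insert_of_notMem his]; omega)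

theorem isConvexAt_sub_linear {a : ι → ℝ} (l : Module.Dual ℝ V) :
    IsConvexAt Δ v t (fun i => a i - l (v i)) ↔ IsConvexAt Δ v t a := by
  constructor
  · intro hc s hs hts
    obtain ⟨m, hm, hpos⟩ := hc s hs hts
    exact ⟨m + l, fun j hj => by simp [hm j hj], fun i hi => by
      have := hpos i hi
      rw [LinearMap.add_apply]; linarith⟩
  · intro hc s hs hts
    obtain ⟨m, hm, hpos⟩ := hc s hs hts
    exact ⟨m - l, fun j hj => by simp [hm j hj], fun i hi => by
      have := hpos i hi
      rw [LinearMap.sub_apply]; linarith⟩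

theorem isLinkConnected_linkComplex (h : IsFanComplex Δ v) (ht : t ∈ Δ) :
    IsLinkConnected (linkComplex Δ t) ∅ ↔ IsLinkConnected Δ t := by
  have h0 : ∅ ∈ linkComplex Δ t := h.mem_linkComplex.2 ⟨by simp, by simpa using ht⟩
  have e0 : linkVertices (linkComplex Δ t) ∅ = linkVertices Δ t := by
    rw [h.linkVertices_linkComplex h0, Finset.empty_union]
  have e1 : ∀ i ∈ linkVertices Δ t, linkVertices (linkComplex Δ t) (insert i ∅) =
      linkVertices Δ (insert i t) := fun i hi => by
    rw [← e0] at hi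
    rw [h.linkVertices_linkComplex (mem_linkVertices.1 hi).2, Finset.insert_union,
      Finset.empty_union]
  rw [IsLinkConnected, IsLinkConnected, e0]
  refine and_congr_right fun _ => forall_congr' fun p => forall_congr' fun _ => imp_congr ?_ Iff.rfl
  exact forall₂_congr fun i hi => by rw [e1 i hi]

section Star

variable {F : Finset (PointedCone ℝ V)} {u : PointedCone ℝ V → V} {w : PointedCone ℝ V → ℝ}

theorem IsFanModel.star (h : IsFanModel F u Δ v) (ht : t ∈ Δ) :
    IsFanModel (star F (coneOf v t)) (starMarking F u (coneOf v t)) (linkComplex Δ t)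
      (linkVector v t) where
  toIsFanComplex := h.toIsFanComplex.link
  image_eq := by
    ext σ
    rw [LorentzianFan.star, Finset.mem_image, Finset.mem_image]
    constructor
    · rintro ⟨s, hs, rfl⟩
      exact ⟨coneOf v s, (h.mem_nbhd ht).2 ⟨s, (h.mem_linkComplex.1 hs).2, rfl⟩, map_coneOf _ v s⟩
    · rintro ⟨π, hπ, rfl⟩
      obtain ⟨s, hs, rfl⟩ := (h.mem_nbhd ht).1 hπ
      exact ⟨s \ t, h.sdiff_mem_linkComplex hs,
        ((map_coneOf _ v s).trans (coneOf_linkVector_sdiff v s)).symm⟩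
  marking i hi := by
    have hi' := (h.mem_linkComplex.1 hi).2
    have hex : ∃ ρ : PointedCone ℝ V, ρ ∈ conesOfDim (nbhd F (coneOf v t)) 1 ∧
        PointedCone.map (coneSpan (coneOf v t)).mkQ ρ = coneOf (linkVector v t) {i} :=
      ⟨coneOf v {i}, Finset.mem_filter.2 ⟨(h.mem_nbhd ht).2 ⟨{i}, hi', rfl⟩, by
        rw [h.coneDim_coneOf (h.down_closed _ hi' _ Finset.subset_union_left),
          Finset.card_singleton]⟩, map_coneOf _ v {i}⟩
    obtain ⟨h1, h2⟩ := Classical.epsilon_spec hex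
    rw [starMarking]
    set ρ := Classical.epsilon fun ρ : PointedCone ℝ V =>
      ρ ∈ conesOfDim (nbhd F (coneOf v t)) 1 ∧
        PointedCone.map (coneSpan (coneOf v t)).mkQ ρ = coneOf (linkVector v t) {i}
    obtain ⟨h3, h4⟩ := Finset.mem_filter.1 h1
    obtain ⟨s, hs, hsρ⟩ := (h.mem_nbhd ht).1 h3
    have hsΔ := h.down_closed _ hs _ Finset.subset_union_left
    rw [← hsρ, h.coneDim_coneOf hsΔ] at h4
    obtain ⟨j, rfl⟩ := Finset.card_eq_one.1 h4
    rw [← hsρ, map_coneOf] at h2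
    -- Cones of the link determine their faces, so the ray picked by `Classical.epsilon` can only be
    -- that of `i`.
    have h5 := h.toIsFanComplex.link.coneOf_injOn (h.sdiff_mem_linkComplex hs) hi
      ((coneOf_linkVector_sdiff v _).symm.trans h2)
    have h6 : i ∈ ({j} : Finset ι) \ t := h5 ▸ Finset.mem_singleton_self i
    have h7 : i = j := Finset.mem_singleton.1 (Finset.mem_sdiff.1 h6).1
    rw [← hsρ, h.marking j hsΔ, ← h7]
    rfl

theorem IsTropicalModel.star (h : IsTropicalModel F u w d Δ v W) (ht : t ∈ Δ) {n : ℕ}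
    (hn : t.card + n = d) :
    IsTropicalModel (star F (coneOf v t)) (starMarking F u (coneOf v t))
      (starWeight F w d (coneOf v t)) n (linkComplex Δ t) (linkVector v t)
      (fun s => W (s ∪ t)) := by
  refine { h.toIsTropicalComplex.link hn, h.toIsFanModel.star ht with weight := ?_ }
  intro s hs hcard
  obtain ⟨hdisj, hst⟩ := h.mem_linkComplex.1 hs
  have hcst : (s ∪ t).card = d := by rw [Finset.card_union_of_disjoint hdisj]; omega
  have hex : ∃ π : PointedCone ℝ V, π ∈ conesOfDim (nbhd F (coneOf v t)) d ∧
      PointedCone.map (coneSpan (coneOf v t)).mkQ π = coneOf (linkVector v t) s :=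
    ⟨coneOf v (s ∪ t), Finset.mem_filter.2 ⟨(h.mem_nbhd ht).2 ⟨s ∪ t, by simpa using hst, rfl⟩, by
      rw [h.coneDim_coneOf hst, hcst]⟩, by
      rw [map_coneOf]
      refine (coneOf_linkVector_sdiff v _).trans ?_
      rw [Finset.union_sdiff_right, Finset.sdiff_eq_self_of_disjoint hdisj]⟩
  obtain ⟨h1, h2⟩ := Classical.epsilon_spec hex
  rw [starWeight]
  set π := Classical.epsilon fun π : PointedCone ℝ V =>
    π ∈ conesOfDim (nbhd F (coneOf v t)) d ∧
      PointedCone.map (coneSpan (coneOf v t)).mkQ π = coneOf (linkVector v t) s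
  obtain ⟨h3, h4⟩ := Finset.mem_filter.1 h1
  obtain ⟨r, hr, hrπ⟩ := (h.mem_nbhd ht).1 h3
  have hrΔ := h.down_closed _ hr _ Finset.subset_union_left
  rw [← hrπ, h.coneDim_coneOf hrΔ] at h4
  -- No face has more than `d` elements, so a `d`-dimensional cone of the neighborhood contains `t`.
  have h5 : r = r ∪ t := Finset.eq_of_subset_of_card_le Finset.subset_union_left
    (by rw [h4]; exact h.card_le _ hr)
  have htr : t ⊆ r := by rw [h5]; exact Finset.subset_union_right
  rw [← hrπ, map_coneOf] at h2
  have h6 := h.toIsFanComplex.link.coneOf_injOn (h.sdiff_mem_linkComplex hr) hs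
    ((coneOf_linkVector_sdiff v _).symm.trans h2)
  rw [← hrπ, ← h6, Finset.sdiff_union_of_subset htr]
  exact h.weight r hrΔ h4

end Star

end Link

/-! ### Divisors and degrees on stars. -/

section StarDivisor

variable {ι V : Type*} [Fintype ι] [AddCommGroup V] [Module ℝ V]
  [TopologicalSpace V] [IsTopologicalAddGroup V] [ContinuousSMul ℝ V] [T2Space V]
  [FiniteDimensional ℝ V]
  {Δ : Finset (Finset ι)} {v : ι → V} {W : Finset ι → ℝ} {d : ℕ} {t : Finset ι}
  {F : Finset (PointedCone ℝ V)} {u : PointedCone ℝ V → V} {w : PointedCone ℝ V → ℝ}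

instance t2Space_quotient_coneSpan (σ : PointedCone ℝ V) : T2Space (V ⧸ coneSpan σ) :=
  have : IsClosed (coneSpan σ : Set V) := Submodule.closed_of_finiteDimensional _
  inferInstance

/-- The divisor on the star at the cone of `t` of the restriction of the piecewise linear function
with values `a`. -/
def starDivisorOf (h : IsFanModel F u Δ v) (ht : t ∈ Δ) :
    (ι → ℝ) →ₗ[ℝ] Divisor (star F (coneOf v t)) :=
  (divisorOf (h.star ht)).comp (normalize v t)

theorem starDivisorOf_surjective (h : IsFanModel F u Δ v) (ht : t ∈ Δ) :
    Function.Surjective (starDivisorOf h ht) := by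
  intro D
  obtain ⟨b, rfl⟩ := divisorOf_surjective (h.star ht) D
  -- Faces of the link avoid `t`, so the values of `b` there are irrelevant; with value 0 on `t`,
  -- `normalize` does nothing.
  set a : ι → ℝ := fun i => if i ∈ t then 0 else b i with ha
  refine ⟨a, ?_⟩
  rw [starDivisorOf, LinearMap.comp_apply, normalize_of_eq_zero v fun i hi => by simp [ha, hi]]
  have : plOf (h.star ht) a = plOf (h.star ht) b := by
    ext x
    obtain ⟨s, hs, hx⟩ := (h.star ht).mem_support.1 x.2
    have hl := fun i hi => (h.star ht).extension_apply hs b (j := i) hi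
    rw [plOf_apply (h.star ht) b hs hl hx, plOf_apply (h.star ht) a hs (fun i hi => ?_) hx]
    rw [hl i hi, ha]
    exact (if_neg (Finset.disjoint_left.1 (h.mem_linkComplex.1 hs).1 hi)).symm
  rw [divisorOf, LinearMap.comp_apply, LinearMap.comp_apply, this]

theorem isStrictlyConvex_starDivisorOf (h : IsFanModel F u Δ v) (ht : t ∈ Δ) (a : ι → ℝ) :
    IsStrictlyConvex (starDivisorOf h ht a) ↔ IsConvexAt Δ v t a := by
  rw [starDivisorOf, LinearMap.comp_apply, isStrictlyConvex_divisorOf,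
    isConvexAt_linkComplex h.toIsFanComplex fun i hi => h.normalize_eq_zero ht a hi]
  exact isConvexAt_sub_linear (extension v t a)

theorem deg_starDivisorOf (h : IsTropicalModel F u w d Δ v W) (ht : t ∈ Δ) (As : List (ι → ℝ))
    (hd : t.card + As.length = d) :
    deg (starMarking F u (coneOf v t)) (starWeight F w d (coneOf v t))
      (As.map (starDivisorOf h.toIsFanModel ht)) = weightProd Δ v W As t := by
  have h0 : ∅ ∈ linkComplex Δ t := h.mem_linkComplex.2 ⟨by simp, by simpa using ht⟩
  have h1 := deg_divisorOf (h.star ht hd) h0 (As.map (normalize v t)) (by simp)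
  rw [List.map_map] at h1
  refine h1.trans ?_
  rw [weightProd_linkComplex h.toIsTropicalComplex _ ?_ ∅ h0 (by simpa using hd),
    Finset.empty_union, weightProd_normalize h.toIsTropicalComplex As t ht hd]
  intro a ha i hi
  obtain ⟨b, -, rfl⟩ := List.mem_map.1 ha
  exact h.normalize_eq_zero ht b hi

end StarDivisor

/-! ### Connectedness of the punctured support. -/

section Connected

variable {ι V : Type*} [Fintype ι] [AddCommGroup V] [Module ℝ V]
  [TopologicalSpace V] [IsTopologicalAddGroup V] [ContinuousSMul ℝ V]
  {Δ : Finset (Finset ι)} {v : ι → V} {F : Finset (PointedCone ℝ V)} {u : PointedCone ℝ V → V}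

/-- Cones of the fan contain no line, by uniqueness of coordinates, so a segment between nonzero
points of one cone misses the origin. -/
theorem IsFanModel.joinedIn (h : IsFanModel F u Δ v) {s : Finset ι} (hs : s ∈ Δ) {x y : V}
    (hx : x ∈ coneOf v s) (hy : y ∈ coneOf v s) (hx0 : x ≠ 0) (hy0 : y ≠ 0) :
    JoinedIn (support F \ {0}) x y := by
  refine JoinedIn.of_segment_subset ?_
  rintro _ ⟨α, β, hα, hβ, hαβ, rfl⟩
  have hmem : α • x + β • y ∈ coneOf v s :=
    add_mem (PointedCone.smul_mem _ hα hx) (PointedCone.smul_mem _ hβ hy)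
  refine ⟨h.mem_support.2 ⟨s, hs, hmem⟩, fun h0 => ?_⟩
  obtain ⟨a, ha, has, rfl⟩ := mem_coneOf.1 hx
  obtain ⟨b, hb, hbs, rfl⟩ := mem_coneOf.1 hy
  have key := h.inj s hs s hs (fun i => α * a i + β * b i) 0
    (fun i => add_nonneg (mul_nonneg hα (ha i)) (mul_nonneg hβ (hb i))) (fun i => le_rfl)
    (fun i hi => by simp [has i hi, hbs i hi]) (fun i _ => rfl) (by
      simp only [Pi.zero_apply, zero_smul, Finset.sum_const_zero, add_smul, mul_smul,
        Finset.sum_add_distrib, ← Finset.smul_sum]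
      exact h0)
  have hzero : ∀ i, α * a i = 0 ∧ β * b i = 0 := fun i => by
    have h1 := congrFun key i
    simp only [Pi.zero_apply] at h1
    have := mul_nonneg hα (ha i)
    have := mul_nonneg hβ (hb i)
    constructor <;> linarith
  rcases hα.lt_or_eq with hα' | rfl
  · exact hx0 (Finset.sum_eq_zero fun i _ => by
      rw [(mul_eq_zero.1 (hzero i).1).resolve_left hα'.ne', zero_smul])
  · have hβ' : β ≠ 0 := by rw [zero_add] at hαβ; simp [hαβ]
    exact hy0 (Finset.sum_eq_zero fun i _ => by
      rw [(mul_eq_zero.1 (hzero i).2).resolve_left hβ', zero_smul])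

/-- The support of a fan without the origin is connected if and only if the `1`-skeleton of the
complex is. -/
theorem IsFanModel.isConnected_support_iff [T2Space V] [FiniteDimensional ℝ V]
    (h : IsFanModel F u Δ v) : IsConnected (support F \ {0}) ↔ IsLinkConnected Δ ∅ := by
  have hvert : ∀ i, i ∈ linkVertices Δ ∅ ↔ {i} ∈ Δ := fun i => by simp [mem_linkVertices]
  have hedge : ∀ i j, j ∈ linkVertices Δ (insert i ∅) ↔ j ≠ i ∧ {j, i} ∈ Δ := fun i j => by
    simp [mem_linkVertices]
  have hcoeff : ∀ (c : ι → ℝ), ∑ i, c i • v i ≠ 0 → ∃ i, c i ≠ 0 := fun c hc => by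
    by_contra! hcon
    exact hc (by simp [hcon])
  constructor
  · rintro ⟨⟨x, hx, hx0⟩, hpre⟩
    refine ⟨?_, ?_⟩
    · obtain ⟨s, hs, hxs⟩ := h.mem_support.1 hx
      obtain ⟨c, -, hcs, rfl⟩ := mem_coneOf.1 hxs
      obtain ⟨i, hi⟩ := hcoeff c hx0
      exact ⟨i, (hvert i).2 (h.singleton_mem hs (by by_contra his; exact hi (hcs i his)))⟩
    · rintro p ⟨i₀, hi₀, hpi₀⟩ hp j₀ hj₀
      by_contra hpj₀
      -- All vertices of a face are joined by edges, so they satisfy `p` together or not at all. The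
      -- closed sets for `p` and its negation cover the punctured support and meet at most in the
      -- origin.
      set A : (ι → Prop) → Set V := fun q => ⋃ s ∈ Δ.filter fun s => ∀ i ∈ s, q i, coneOf v s
        with hA
      have hmemA : ∀ q x, x ∈ A q ↔ ∃ s ∈ Δ, (∀ i ∈ s, q i) ∧ x ∈ coneOf v s := fun q x => by
        simp [hA, and_assoc]
      have hclosed : ∀ q, IsClosed (A q) := fun q => by
        refine Set.Finite.isClosed_biUnion (Finset.finite_toSet _) fun s hs => ?_
        exact h.isClosed_coneOf (Finset.mem_filter.1 hs).1
      have hmemv : ∀ q i, i ∈ linkVertices Δ ∅ → q i → v i ∈ (support F \ {0}) ∩ A q :=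
        fun q i hi hq => by
          have hi' := (hvert i).1 hi
          have hii := Finset.mem_singleton_self i
          exact ⟨h.apply_mem_support hi' hii, (hmemA q _).2 ⟨{i}, hi', by simpa using hq,
            apply_mem_coneOf v hii⟩⟩
      have hcover : support F \ {0} ⊆ A p ∪ A fun i => ¬ p i := by
        rintro x ⟨hx, hx0⟩
        obtain ⟨s, hs, hxs⟩ := h.mem_support.1 hx
        obtain ⟨c, hc, hcs, rfl⟩ := mem_coneOf.1 hxs
        obtain ⟨i, hi⟩ := hcoeff c hx0
        set r := Finset.univ.filter fun i => c i ≠ 0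
        have hrs : r ⊆ s := fun j hj => by
          by_contra hjs; exact (Finset.mem_filter.1 hj).2 (hcs j hjs)
        have hr := h.down_closed s hs r hrs
        have hir : i ∈ r := Finset.mem_filter.2 ⟨Finset.mem_univ i, hi⟩
        have hxr : ∑ i, c i • v i ∈ coneOf v r := mem_coneOf.2 ⟨c, hc, fun j hj => by
          by_contra hne; exact hj (Finset.mem_filter.2 ⟨Finset.mem_univ j, hne⟩), rfl⟩
        have hstep : ∀ j ∈ r, ∀ k ∈ r, p j → p k := fun j hj k hk hpj => by
          rcases eq_or_ne k j with rfl | hkj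
          · exact hpj
          · refine hp j ((hvert j).2 (h.singleton_mem hr hj)) k ((hedge j k).2 ⟨hkj, ?_⟩) hpj
            exact h.down_closed r hr _ (Finset.insert_subset hk (Finset.singleton_subset_iff.2 hj))
        by_cases hpi : p i
        · exact Or.inl ((hmemA _ _).2 ⟨r, hr, fun j hj => hstep i hir j hj hpi, hxr⟩)
        · exact Or.inr ((hmemA _ _).2 ⟨r, hr, fun j hj hpj => hpi (hstep j hj i hir hpj), hxr⟩)
      obtain ⟨x, hx, hx1, hx2⟩ := isPreconnected_closed_iff.1 hpre (A p) (A fun i => ¬ p i)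
        (hclosed _) (hclosed _) hcover ⟨_, hmemv p i₀ hi₀ hpi₀⟩
        ⟨_, hmemv (fun i => ¬ p i) j₀ hj₀ hpj₀⟩
      obtain ⟨s, hs, hsp, hxs⟩ := (hmemA _ _).1 hx1
      obtain ⟨r, hr, hrp, hxr⟩ := (hmemA _ _).1 hx2
      obtain ⟨a, ha, has, rfl⟩ := mem_coneOf.1 hxs
      obtain ⟨b, hb, hbr, hab⟩ := mem_coneOf.1 hxr
      obtain ⟨i, hi⟩ := hcoeff a hx.2
      have hab' := h.inj s hs r hr a b ha hb has hbr hab.symm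
      have his : i ∈ s := by by_contra his; exact hi (has i his)
      have hir : i ∈ r := by by_contra hir; exact hi (by rw [hab', hbr i hir])
      exact hrp i hir (hsp i his)
  · rintro ⟨⟨i₀, hi₀⟩, hconn⟩
    have hi₀' := (hvert i₀).1 hi₀
    -- Edge paths of the complex become chains of segments between marks.
    have hall : ∀ i ∈ linkVertices Δ ∅, JoinedIn (support F \ {0}) (v i₀) (v i) := by
      refine hconn (fun i => JoinedIn (support F \ {0}) (v i₀) (v i)) ⟨i₀, hi₀,
        JoinedIn.refl (h.apply_mem_support hi₀' (Finset.mem_singleton_self _))⟩ ?_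
      intro i hi j hj hpi
      obtain ⟨-, hij⟩ := (hedge i j).1 hj
      have h1 : j ∈ ({j, i} : Finset ι) := by simp
      have h2 : i ∈ ({j, i} : Finset ι) := by simp
      exact hpi.trans (h.joinedIn hij (apply_mem_coneOf v h2) (apply_mem_coneOf v h1)
        (h.apply_ne_zero hij h2) (h.apply_ne_zero hij h1))
    refine IsPathConnected.isConnected ⟨v i₀,
      h.apply_mem_support hi₀' (Finset.mem_singleton_self _), ?_⟩
    rintro x ⟨hx, hx0⟩
    obtain ⟨s, hs, hxs⟩ := h.mem_support.1 hx
    obtain ⟨c, -, hcs, hcx⟩ := mem_coneOf.1 hxs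
    obtain ⟨i, hi⟩ := hcoeff c (by rw [hcx]; exact hx0)
    have his : i ∈ s := by by_contra his; exact hi (hcs i his)
    exact (hall i ((hvert i).2 (h.singleton_mem hs his))).trans
      (h.joinedIn hs (apply_mem_coneOf v his) hxs (h.apply_ne_zero hs his) hx0)

end Connected

/-! ### Translation of the criterion, and the theorem. -/

section Main

variable {ι V : Type*} [Fintype ι] [AddCommGroup V] [Module ℝ V]
  [TopologicalSpace V] [IsTopologicalAddGroup V] [ContinuousSMul ℝ V] [T2Space V]
  [FiniteDimensional ℝ V]
  {Δ : Finset (Finset ι)} {v : ι → V} {W : Finset ι → ℝ} {d : ℕ} {t : Finset ι}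
  {F : Finset (PointedCone ℝ V)} {u : PointedCone ℝ V → V} {w : PointedCone ℝ V → ℝ}

theorem isUnpinched_iff (h : IsFanModel F u Δ v) :
    IsUnpinched F d ↔ ∀ t ∈ Δ, t.card + 2 ≤ d → IsLinkConnected Δ t := by
  have key : ∀ t ∈ Δ, (coneDim (coneOf v t) + 2 ≤ d →
      IsConnected (support (star F (coneOf v t)) \ {0})) ↔
      (t.card + 2 ≤ d → IsLinkConnected Δ t) := fun t ht => by
    rw [h.coneDim_coneOf ht, (h.star ht).isConnected_support_iff,
      isLinkConnected_linkComplex h.toIsFanComplex ht]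
  constructor
  · exact fun H t ht => (key t ht).1 (H _ (h.coneOf_mem ht))
  · intro H τ hτ
    obtain ⟨t, ht, rfl⟩ := h.mem_iff.1 hτ
    exact (key t ht).2 (H t ht)

theorem isQuasiprojective_iff (h : IsFanModel F u Δ v) :
    IsQuasiprojective F ↔ ∃ a, IsConvexAt Δ v ∅ a := by
  rw [IsQuasiprojective, (divisorOf_surjective h).exists]
  exact exists_congr fun a => isStrictlyConvex_divisorOf h a

theorem hasOnePositiveEigenvalue_star_iff (h : IsTropicalModel F u w d Δ v W) (ht : t ∈ Δ)
    (As : List (ι → ℝ)) (hd : t.card + (As.length + 2) = d) :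
    (HasOnePositiveEigenvalue fun D₁ D₂ : Divisor (star F (coneOf v t)) =>
      deg (starMarking F u (coneOf v t)) (starWeight F w d (coneOf v t))
        (D₁ :: D₂ :: As.map (starDivisorOf h.toIsFanModel ht))) ↔
      IsHyperbolic (degForm Δ v W t As) := by
  have hsurj := starDivisorOf_surjective h.toIsFanModel ht
  -- Divisors form a quotient of the functions on the finite set `ι`, so the eigenvalue criterion in
  -- finite dimension applies.
  have := Module.Finite.of_surjective _ hsurj
  rw [hasOnePositiveEigenvalue_iff, ← IsHyperbolic.comp_iff _ hsurj]
  have : (fun x y => deg (starMarking F u (coneOf v t)) (starWeight F w d (coneOf v t))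
      (starDivisorOf h.toIsFanModel ht x :: starDivisorOf h.toIsFanModel ht y ::
        As.map (starDivisorOf h.toIsFanModel ht))) = degForm Δ v W t As :=
    funext₂ fun x y => deg_starDivisorOf h ht (x :: y :: As) hd
  rw [this]

theorem hasOnePositiveEigenvalue_iff_degForm (h : IsTropicalModel F u w 2 Δ v W) (h0 : ∅ ∈ Δ) :
    (HasOnePositiveEigenvalue fun D₁ D₂ : Divisor F => deg u w [D₁, D₂]) ↔
      IsHyperbolic (degForm Δ v W ∅ []) := by
  have hsurj := divisorOf_surjective h.toIsFanModel
  have := Module.Finite.of_surjective _ hsurj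
  rw [hasOnePositiveEigenvalue_iff, ← IsHyperbolic.comp_iff _ hsurj]
  have : (fun x y => deg u w [divisorOf h.toIsFanModel x, divisorOf h.toIsFanModel y]) =
      degForm Δ v W ∅ [] := funext₂ fun x y => deg_divisorOf h h0 [x, y] rfl
  rw [this]

theorem isLorentzian_iff (h : IsTropicalModel F u w d Δ v W) :
    IsLorentzian F u w d ↔ (∃ a, IsConvexAt Δ v ∅ a) ∧
      ∀ t ∈ Δ, ∀ As : List (ι → ℝ), t.card + (As.length + 2) = d →
        (∀ a ∈ As, IsConvexAt Δ v t a) → IsHyperbolic (degForm Δ v W t As) := by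
  refine and_congr (isQuasiprojective_iff h.toIsFanModel) ?_
  constructor
  · intro H t ht As hd hAs
    rw [← hasOnePositiveEigenvalue_star_iff h ht As hd]
    refine H _ (h.coneOf_mem ht) _ (by rwa [h.coneDim_coneOf ht, List.length_map]) fun D hD => ?_
    obtain ⟨a, ha, rfl⟩ := List.mem_map.1 hD
    exact (isStrictlyConvex_starDivisorOf h.toIsFanModel ht a).2 (hAs a ha)
  · intro H τ hτ Ds hd hDs
    obtain ⟨t, ht, rfl⟩ := h.mem_iff.1 hτ
    obtain ⟨As, rfl⟩ :=
      (List.map_surjective_iff.2 (starDivisorOf_surjective h.toIsFanModel ht)) Ds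
    rw [h.coneDim_coneOf ht, List.length_map] at hd
    refine (hasOnePositiveEigenvalue_star_iff h ht As hd).2 (H t ht As hd fun a ha => ?_)
    exact (isStrictlyConvex_starDivisorOf h.toIsFanModel ht a).1 (hDs _ (List.mem_map_of_mem ha))

/-- A quasiprojective marked tropical `2`-fan is Lorentzian if and only if its degree form has
exactly one positive eigenvalue. -/
theorem isLorentzian_two_iff (h : IsTropicalModel F u w 2 Δ v W) (h0 : ∅ ∈ Δ)
    (hq : ∃ a, IsConvexAt Δ v ∅ a) :
    IsLorentzian F u w 2 ↔
      HasOnePositiveEigenvalue fun D₁ D₂ : Divisor F => deg u w [D₁, D₂] := by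
  rw [isLorentzian_iff h, hasOnePositiveEigenvalue_iff_degForm h h0, and_iff_right hq]
  refine ⟨fun H => H ∅ h0 [] rfl (by simp), fun H t ht As hd _ => ?_⟩
  have h1 : t = ∅ := Finset.card_eq_zero.1 (by omega)
  have h2 : As = [] := List.length_eq_zero_iff.1 (by omega)
  rwa [h1, h2]

/-- A function convex everywhere is convex around `t`, so the star inherits quasiprojectivity, and
the two-dimensional case applies to it. -/
theorem isLorentzian_star_iff (h : IsTropicalModel F u w d Δ v W)
    (hq : ∃ a, IsConvexAt Δ v ∅ a) (ht : t ∈ Δ) (hd : t.card + 2 = d) :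
    IsLorentzian (star F (coneOf v t)) (starMarking F u (coneOf v t))
        (starWeight F w d (coneOf v t)) 2 ↔
      HasOnePositiveEigenvalue fun D₁ D₂ : Divisor (star F (coneOf v t)) =>
        deg (starMarking F u (coneOf v t)) (starWeight F w d (coneOf v t)) [D₁, D₂] := by
  obtain ⟨a, ha⟩ := hq
  refine isLorentzian_two_iff (h.star ht hd)
    (h.mem_linkComplex.2 ⟨Finset.disjoint_empty_left t, by simpa using ht⟩)
    ((isQuasiprojective_iff (h.toIsFanModel.star ht)).1 ⟨starDivisorOf h.toIsFanModel ht a, ?_⟩)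
  exact (isStrictlyConvex_starDivisorOf h.toIsFanModel ht a).2 (ha.mono (Finset.empty_subset t))

end Main

end LorentzianFan

end

theorem mainTheorem1 {V : Type*} [AddCommGroup V] [Module ℝ V] [FiniteDimensional ℝ V]
    [TopologicalSpace V] [IsTopologicalAddGroup V] [ContinuousSMul ℝ V] [T2Space V]
    (d : ℕ) (F : Finset (PointedCone ℝ V)) (u : PointedCone ℝ V → V) (w : PointedCone ℝ V → ℝ)
    (htrop : LorentzianFan.IsTropicalFan F u w d)
    (hquasi : LorentzianFan.IsQuasiprojective F) :
    (LorentzianFan.IsLorentzian F u w d ↔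
      LorentzianFan.IsUnpinched F d ∧
      ∀ τ ∈ F, LorentzianFan.coneDim τ + 2 = d →
        LorentzianFan.IsLorentzian (LorentzianFan.star F τ)
          (LorentzianFan.starMarking F u τ) (LorentzianFan.starWeight F w d τ) 2) ∧
    (∀ τ ∈ F, LorentzianFan.coneDim τ + 2 = d →
      (LorentzianFan.IsLorentzian (LorentzianFan.star F τ)
          (LorentzianFan.starMarking F u τ) (LorentzianFan.starWeight F w d τ) 2 ↔
        LorentzianFan.HasOnePositiveEigenvalue
          fun D₁ D₂ : LorentzianFan.Divisor (LorentzianFan.star F τ) =>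
            LorentzianFan.deg (LorentzianFan.starMarking F u τ)
              (LorentzianFan.starWeight F w d τ) [D₁, D₂])) := by
  have hm := htrop.isTropicalModel
    (LorentzianFan.isFanModel_rayComplex htrop.isSimplicialFan htrop.isMarking)
  have hq := (LorentzianFan.isQuasiprojective_iff hm.toIsFanModel).1 hquasi
  have hstar : ∀ t ∈ LorentzianFan.rayComplex F, ∀ hd : t.card + 2 = d, _ :=
    fun t ht hd => LorentzianFan.isLorentzian_star_iff hm hq ht hd
  refine ⟨?_, fun τ hτ hd => ?_⟩
  · rw [LorentzianFan.isLorentzian_iff hm, LorentzianFan.isUnpinched_iff hm.toIsFanModel,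
      and_iff_right hq]
    constructor
    · intro H
      refine ⟨fun t ht hd => ?_, fun τ hτ hd => ?_⟩
      · obtain ⟨a, ha⟩ := hq
        have hat := ha.mono (Finset.empty_subset t)
        -- All remaining divisors are taken equal to the given strictly convex one.
        refine LorentzianFan.isLinkConnected_of_isHyperbolic hm.toIsTropicalComplex ht hat
          (n := d - (t.card + 2)) (by omega) (H t ht _ (by simp; omega) fun b hb => ?_)
        rwa [List.eq_of_mem_replicate hb]
      · obtain ⟨t, ht, rfl⟩ := hm.mem_iff.1 hτ
        rw [hm.coneDim_coneOf ht] at hd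
        -- In codimension two no divisor remains, and the form in question is that of the empty
        -- list.
        exact (hstar t ht hd).2 ((LorentzianFan.hasOnePositiveEigenvalue_star_iff hm ht [] hd).2
          (H t ht [] hd (by simp)))
    · rintro ⟨hconn, hB⟩ t ht As hd hAs
      refine LorentzianFan.isHyperbolic_degForm hm.toIsTropicalComplex hconn (fun t ht hd => ?_)
        As t ht (by omega) hAs
      have := hB _ (hm.coneOf_mem ht) (by rwa [hm.coneDim_coneOf ht])
      exact (LorentzianFan.hasOnePositiveEigenvalue_star_iff hm ht [] hd).1 ((hstar t ht hd).1 this)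
  · obtain ⟨t, ht, rfl⟩ := hm.mem_iff.1 hτ
    rw [hm.coneDim_coneOf ht] at hd
    exact hstar t ht hd
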